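/- **Setting and notation.** Let $\overline X=(X_0,X_1)$ be a compatible couple of (quasi-)Banach spaces, that is, two (quasi-)Banach spaces continuously embedded in a Hausdorff topological vector space, and let, for $f\in X_0+X_1$ and $t>0$, $$K(t,f)=K(t,f;X_0,X_1)=\inf\{\|f_0\|_{X_0}+t\|f_1\|_{X_1}: f=f_0+f_1,\ f_i\in X_i\}.$$ An *r.i. space* is a rearrangement invariant Banach function space $E$ on $(0,\infty)$ with Lebesgue measure $dt$, having the Fatou property. $\widetilde E$ denotes the corresponding space for the measure $dt/t$ on $(0,\infty)$: $\|f\|_{\widetilde E}=\|f^{\star}\|_E$, where $f^{\star}$ is the non-increasing rearrangement of $f$ with respect to $dt/t$. For an interval $I\subset(0,\infty)$, $\|f\|_{\widetilde E(I)}=\|f\chi_I\|_{\widetilde E}$. A Lebesgue measurable function $\mathrm b:(0,\infty)\to(0,\infty)$ is *slowly varying*, $\mathrm b\in SV$, if for every $\varepsilon>0$ the function $t^{\varepsilon}\mathrm b(t)$ is equivalent on $(0,\infty)$ to a non-decreasing function and $t^{-\varepsilon}\mathrm b(t)$ is equivalent to a non-increasing function (two functions being equivalent if each is bounded by a positive constant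 times the other). For $0<\theta<1$, $a,\mathrm b\in SV$ and r.i. spaces $E,F$, let $\overline X^{\mathcal R}_{\theta,\mathrm b,E,a,F}$ and $\overline X^{\mathcal L}_{\theta,\mathrm b,E,a,F}$ be the spaces of all $f\in X_0+X_1$ for which, respectively, $$\Big\|\mathrm b(t)\,\|s^{-\theta}a(s)K(s,f)\|_{\widetilde F(t,\infty)}\Big\|_{\widetilde E}<\infty,\qquad \Big\|\mathrm b(t)\,\|s^{-\theta}a(s)K(s,f)\|_{\widetilde F(0,t)}\Big\|_{\widetilde E}<\infty,$$ (quasi-)normed by these expressions; here $s$ is the variable of the inner norm and $t$ that of the outer one. **Theorem.** Let $0<\theta_0<\theta_1<1$, let $E_0,E_1,F_0,F_1$ be r.i. spaces and let $a_0,a_1,\mathrm b_0,\mathrm b_1\in SV$ be such that $\|\mathrm b_0\|_{\widetilde E_0(0,1)}<\infty$ and $\|\mathrm b_1\|_{\widetilde E_1(1,\infty)}<\infty$. Put $Y_0=\overline X^{\mathcal R}_{\theta_0,\mathrm b_0,E_0,a_0,F_0}$, $Y_1=\overline X^{\mathcal L}_{\theta_1,\mathrm b_1,E_1,a_1,F_1}$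 and $$\rho(u)=u^{\theta_1-\theta_0}\,\frac{a_0(u)\,\|\mathrm b_0\|_{\widetilde E_0(0,u)}}{a_1(u)\,\|\mathrm b_1\|_{\widetilde E_1(u,\infty)}},\qquad u>0.$$ Then there is a constant $C>0$ such that for every $f\in Y_0+Y_1$ and every $u>0$ $$C^{-1}H(f,u)\le K\big(\rho(u),f;Y_0,Y_1\big)\le C\,H(f,u),$$ where $$H(f,u)=\Big\|\mathrm b_0(t)\,\|s^{-\theta_0}a_0(s)K(s,f)\|_{\widetilde F_0(t,u)}\Big\|_{\widetilde E_0(0,u)}+\rho(u)\,\Big\|\mathrm b_1(t)\,\|s^{-\theta_1}a_1(s)K(s,f)\|_{\widetilde F_1(u,t)}\Big\|_{\widetilde E_1(u,\infty)}.$$ -/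

import Mathlib

open Set Filter Topology MeasureTheory
open scoped NNReal ENNReal

noncomputable section

/-- Lebesgue measure `dt` on `(0, ∞)`. -/
def lebPos : Measure ℝ := volume.restrict (Ioi 0)

/-- The homogeneous measure `dt / t` on `(0, ∞)`. -/
def homPos : Measure ℝ := lebPos.withDensity fun t => ENNReal.ofReal t⁻¹

/-- The non-increasing rearrangement of a nonnegative function `f` with respect to `μ`:
`f^*(t) = inf {s ≥ 0 : μ {f > s} ≤ t}`, for `t > 0`. -/
def rearrangement (μ : Measure ℝ) (f : ℝ → ℝ≥0∞) (t : ℝ) : ℝ≥0∞ :=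
  sInf {s : ℝ≥0∞ | μ {x | s < f x} ≤ ENNReal.ofReal t}

/-- A rearrangement invariant Banach function space on `(0, ∞)` (with Lebesgue measure), given by
its function norm on nonnegative measurable functions; the space consists of the measurable `f`
with `norm |f| < ∞`. The axioms are those of a Banach function norm with the Fatou property,
together with rearrangement invariance. -/
structure RISpace where
  norm : (ℝ → ℝ≥0∞) → ℝ≥0∞
  norm_eq_zero_iff : ∀ f, AEMeasurable f lebPos → (norm f = 0 ↔ f =ᵐ[lebPos] 0)
  norm_smul : ∀ (c : ℝ≥0) (f : ℝ → ℝ≥0∞), AEMeasurable f lebPos →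
    norm (fun t => c * f t) = c * norm f
  norm_add_le : ∀ f g, AEMeasurable f lebPos → AEMeasurable g lebPos →
    norm (fun t => f t + g t) ≤ norm f + norm g
  norm_mono : ∀ f g, AEMeasurable f lebPos → AEMeasurable g lebPos → f ≤ᵐ[lebPos] g →
    norm f ≤ norm g
  /-- the Fatou property -/
  norm_iSup : ∀ f : ℕ → ℝ → ℝ≥0∞, (∀ n, AEMeasurable (f n) lebPos) → Monotone f →
    norm (fun t => ⨆ n, f n t) = ⨆ n, norm (f n)
  norm_indicator_lt_top : ∀ S : Set ℝ, MeasurableSet S → lebPos S < ∞ →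
    norm (S.indicator fun _ => 1) < ∞
  setLIntegral_le : ∀ S : Set ℝ, MeasurableSet S → lebPos S < ∞ →
    ∃ C : ℝ≥0, ∀ f, AEMeasurable f lebPos → ∫⁻ t in S, f t ∂lebPos ≤ C * norm f
  /-- rearrangement invariance -/
  norm_le_of_rearrangement_le : ∀ f g, AEMeasurable f lebPos → AEMeasurable g lebPos →
    (∀ t, 0 < t → rearrangement lebPos f t ≤ rearrangement lebPos g t) → norm f ≤ norm g

/-- The norm of `Ẽ`, the copy of the r.i. space `E` over `((0, ∞), dt / t)`: the norm in `E` of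
the non-increasing rearrangement with respect to `dt / t`. -/
def RISpace.tildeNorm (E : RISpace) (f : ℝ → ℝ≥0∞) : ℝ≥0∞ :=
  E.norm (rearrangement homPos f)

/-- The norm of the restriction `Ẽ(I)` of `Ẽ` to a subset `I` of `(0, ∞)`. -/
def RISpace.tildeNormOn (E : RISpace) (I : Set ℝ) (f : ℝ → ℝ≥0∞) : ℝ≥0∞ :=
  E.tildeNorm (I.indicator f)

/-- Slowly varying functions on `(0, ∞)` (values at `t ≤ 0` are irrelevant). -/
structure SlowlyVarying (b : ℝ → ℝ) : Prop where
  pos : ∀ t, 0 < t → 0 < b t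
  aemeasurable : AEMeasurable b lebPos
  equiv_monotone : ∀ ε : ℝ, 0 < ε → ∃ φ : ℝ → ℝ, MonotoneOn φ (Ioi 0) ∧
    ∃ C : ℝ, 0 < C ∧ ∀ t, 0 < t → t ^ ε * b t ≤ C * φ t ∧ φ t ≤ C * (t ^ ε * b t)
  equiv_antitone : ∀ ε : ℝ, 0 < ε → ∃ φ : ℝ → ℝ, AntitoneOn φ (Ioi 0) ∧
    ∃ C : ℝ, 0 < C ∧ ∀ t, 0 < t → t ^ (-ε) * b t ≤ C * φ t ∧ φ t ≤ C * (t ^ (-ε) * b t)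

/-- A quasi-Banach space continuously embedded in the topological vector space `V`, given by its
quasi-norm, extended by the value `∞` off the space. A compatible (quasi-)Banach couple is a pair
of such spaces with `V` Hausdorff. -/
structure QuasiBanachIn (𝕜 V : Type*) [RCLike 𝕜] [AddCommGroup V] [Module 𝕜 V]
    [TopologicalSpace V] where
  qnorm : V → ℝ≥0∞
  qnorm_eq_zero_iff : ∀ f, qnorm f = 0 ↔ f = 0
  qnorm_smul : ∀ (c : 𝕜) (f : V), qnorm (c • f) = ‖c‖ₑ * qnorm f
  qnorm_add_le : ∃ κ : ℝ≥0, ∀ f g, qnorm (f + g) ≤ κ * (qnorm f + qnorm g)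
  complete : ∀ x : ℕ → V, (∀ n, qnorm (x n) < ∞) →
    (∀ ε : ℝ≥0∞, 0 < ε → ∃ N, ∀ m n, N ≤ m → N ≤ n → qnorm (x m - x n) < ε) →
    ∃ f, qnorm f < ∞ ∧ Tendsto (fun n => qnorm (x n - f)) atTop (𝓝 0)
  /-- continuity of the embedding into `V` -/
  embedding : ∀ U ∈ 𝓝 (0 : V), ∃ ε : ℝ≥0∞, 0 < ε ∧ ∀ f, qnorm f < ε → f ∈ U

section Interpolation

variable {V : Type*} [AddCommGroup V]

/-- The sum `X₀ + X₁` of the spaces `Xᵢ = {f | Nᵢ f < ∞}`. -/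
def sumSpace (N₀ N₁ : V → ℝ≥0∞) : Set V :=
  {f | ∃ f₀ f₁, N₀ f₀ < ∞ ∧ N₁ f₁ < ∞ ∧ f = f₀ + f₁}

/-- Peetre's `K`-functional `K(t, f; X₀, X₁)` of the spaces `Xᵢ = {f | Nᵢ f < ∞}`. -/
def peetreK (N₀ N₁ : V → ℝ≥0∞) (t : ℝ≥0∞) (f : V) : ℝ≥0∞ :=
  ⨅ (f₀ : V) (f₁ : V) (_ : N₀ f₀ < ∞ ∧ N₁ f₁ < ∞ ∧ f = f₀ + f₁), N₀ f₀ + t * N₁ f₁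

/-- The function `s ↦ s^(-θ) a(s) K(s, f; X₀, X₁)`. -/
def weightedK (N₀ N₁ : V → ℝ≥0∞) (θ : ℝ) (a : ℝ → ℝ) (f : V) (s : ℝ) : ℝ≥0∞ :=
  ENNReal.ofReal (s ^ (-θ) * a s) * peetreK N₀ N₁ (ENNReal.ofReal s) f

open Classical in
/-- The norm of the `R`-space of `(X₀, X₁)`, `‖ b(t) ‖ s^(-θ) a(s) K(s, f) ‖_{F̃(t,∞)} ‖_Ẽ` for
`f ∈ X₀ + X₁`, extended by `∞` off `X₀ + X₁`. -/
def normR (N₀ N₁ : V → ℝ≥0∞) (θ : ℝ) (b : ℝ → ℝ) (E : RISpace) (a : ℝ → ℝ) (F : RISpace)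
    (f : V) : ℝ≥0∞ :=
  if f ∈ sumSpace N₀ N₁ then
    E.tildeNorm fun t => ENNReal.ofReal (b t) * F.tildeNormOn (Ioi t) (weightedK N₀ N₁ θ a f)
  else ∞

open Classical in
/-- The norm of the `L`-space of `(X₀, X₁)`, `‖ b(t) ‖ s^(-θ) a(s) K(s, f) ‖_{F̃(0,t)} ‖_Ẽ` for
`f ∈ X₀ + X₁`, extended by `∞` off `X₀ + X₁`. -/
def normL (N₀ N₁ : V → ℝ≥0∞) (θ : ℝ) (b : ℝ → ℝ) (E : RISpace) (a : ℝ → ℝ) (F : RISpace)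
    (f : V) : ℝ≥0∞ :=
  if f ∈ sumSpace N₀ N₁ then
    E.tildeNorm fun t => ENNReal.ofReal (b t) * F.tildeNormOn (Ioo 0 t) (weightedK N₀ N₁ θ a f)
  else ∞

end Interpolation

/-- `ρ(u) = u^(θ₁ - θ₀) a₀(u) ‖b₀‖_{Ẽ₀(0,u)} / (a₁(u) ‖b₁‖_{Ẽ₁(u,∞)})`. -/
def rhoRL (θ₀ θ₁ : ℝ) (b₀ b₁ a₀ a₁ : ℝ → ℝ) (E₀ E₁ : RISpace) (u : ℝ) : ℝ≥0∞ :=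
  ENNReal.ofReal (u ^ (θ₁ - θ₀)) *
    ((ENNReal.ofReal (a₀ u) * E₀.tildeNormOn (Ioo 0 u) fun t => ENNReal.ofReal (b₀ t)) /
      (ENNReal.ofReal (a₁ u) * E₁.tildeNormOn (Ioi u) fun t => ENNReal.ofReal (b₁ t)))

end

/-! The argument is Holmstedt's. Write `h₀ f u`, `h₁ f u` for the two truncated iterated norms in
`H`, `Bᵢ` for the norms of `bᵢ` in `rhoRL`, and `wᵢ(s) = s^(-θᵢ) aᵢ(s)`. The function `ρ` is chosen
so that `ρ w₁ B₁ = w₀ B₀` (`rhoRL_mul`).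

Upper bound: split `f = f₀ + f₁` almost optimally for `K(u, f; X₀, X₁)`. Up to constants, `K(s, f₀)`
is at most `K(s, f)` below `u` and `K(u, f)` above it, while `K(s, f₁)` is at most `(s/u) K(u, f)`
below `u` and `K(s, f)` above it (`exists_decomposition`). Since `0 < θ₀` and `θ₁ < 1`, the parts on
the wrong side of `u` are controlled by their value at `u`. So the norm of `fᵢ` is bounded by `hᵢ f
u` plus a boundary term `wᵢ(u) K(u, f) Bᵢ(u)` (`exists_iterNorm_Ioi_le`, `exists_iterNorm_Ioo_le`).
After weighting by `ρ` the two boundary terms coincide, and `h₀ f u` absorbs them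
(`exists_powerWeight_mul_le_iterNorm_Ioo`).

Lower bound: for any `f = g₀ + g₁`, the quasi-triangle inequality reduces `H f u` to four terms. Two
are restrictions of the full norms. For the cross terms, a bound on a norm gives a pointwise bound
on the `K`-functional, which is integrated against the other weight; this converges because `θ₀ <
θ₁` (`exists_mul_iterNorm_Ioi_le`, `exists_mul_iterNorm_Ioo_le`).

About the r.i. norms, these estimates need little beyond the lattice and triangle inequalities over
`dt / t`: decaying exponentials have finite norm, and the intervals `(u, 2u)` all have the same
positive measure. Slow variation enters only as the two-point estimate `PowerBounded`. -/

noncomputable section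

/-! ### The measure `dt / t` as an image of Lebesgue measure on the half-line. -/

theorem homPos_eq_map_exp : homPos = Measure.map Real.exp volume := by
  ext S hS
  rw [Measure.map_apply Real.measurable_exp hS, homPos, withDensity_apply _ hS, lebPos,
    Measure.restrict_restrict hS]
  have himg : Real.exp '' (Real.exp ⁻¹' S) = S ∩ Ioi 0 := by
    rw [image_preimage_eq_inter_range, Real.range_exp]
  rw [← himg, lintegral_image_eq_lintegral_abs_deriv_mul (Real.measurable_exp hS)
    (fun x _ => (Real.hasDerivAt_exp x).hasDerivWithinAt) Real.exp_injective.injOn]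
  have h : ∀ x, ENNReal.ofReal |Real.exp x| * ENNReal.ofReal (Real.exp x)⁻¹ = 1 := fun x => by
    rw [← ENNReal.ofReal_mul (abs_nonneg _), abs_of_pos (Real.exp_pos x),
      mul_inv_cancel₀ (Real.exp_pos x).ne', ENNReal.ofReal_one]
  simp_rw [abs_of_pos (Real.exp_pos _)] at h ⊢
  simp [h]

theorem homPos_Ioo {u v : ℝ} (hu : 0 < u) (huv : u ≤ v) :
    homPos (Ioo u v) = ENNReal.ofReal (Real.log (v / u)) := by
  have h : Real.exp ⁻¹' Ioo u v = Ioo (Real.log u) (Real.log v) := by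
    ext x
    simp [Real.lt_log_iff_exp_lt (hu.trans_le huv), Real.log_lt_iff_lt_exp hu]
  rw [homPos_eq_map_exp, Measure.map_apply Real.measurable_exp measurableSet_Ioo, h,
    Real.volume_Ioo, Real.log_div (hu.trans_le huv).ne' hu.ne']

theorem homPos_absolutelyContinuous : homPos ≪ lebPos := withDensity_absolutelyContinuous _ _

theorem ae_homPos_pos : ∀ᵐ t ∂homPos, 0 < t :=
  homPos_absolutelyContinuous.ae_le (ae_restrict_mem measurableSet_Ioi)

instance : NullSingletonClass homPos := by
  rw [homPos_eq_map_exp]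
  refine ⟨fun x => ?_⟩
  rw [Measure.map_apply Real.measurable_exp (measurableSet_singleton x)]
  exact (subsingleton_singleton.preimage Real.exp_injective).measure_zero _

/-- A rearrangement of the unit intervals `[n, n + 1)`, `n : ℕ`, into all intervals
`[z, z + 1)`, `z : ℤ`. -/
def halfLineToLine (x : ℝ) : ℝ := Int.fract x + (Equiv.intEquivNat.symm ⌊x⌋₊ : ℤ)

theorem measurable_halfLineToLine : Measurable halfLineToLine := by
  unfold halfLineToLine
  refine measurable_fract.add ?_
  exact (measurable_from_top (f := fun n : ℕ => ((Equiv.intEquivNat.symm n : ℤ) : ℝ))).comp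
    Nat.measurable_floor

theorem volume_restrict_Ico_add (z : ℝ) :
    volume.restrict (Ico z (z + 1)) =
      Measure.map (fun x => x + z) (volume.restrict (Ico (0 : ℝ) 1)) := by
  have h := (measurePreserving_add_right (volume : Measure ℝ) z).restrict_preimage
    (s := Ico z (z + 1)) measurableSet_Ico
  rw [← h.map_eq]
  congr 2
  ext x
  simp [add_comm]

theorem volume_eq_sum_restrict :
    (volume : Measure ℝ) = Measure.sum fun z : ℤ => volume.restrict (Ico (z : ℝ) (z + 1)) := by
  rw [← Measure.restrict_iUnion (pairwise_disjoint_Ico_intCast ℝ) (fun _ => measurableSet_Ico),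
    iUnion_Ico_intCast, Measure.restrict_univ]

theorem lebPos_eq_sum_restrict :
    lebPos = Measure.sum fun n : ℕ => volume.restrict (Ico (n : ℝ) (n + 1)) := by
  have hd : Pairwise (Function.onFun Disjoint fun n : ℕ => Ico (n : ℝ) (n + 1)) := by
    intro m n hmn
    have := pairwise_disjoint_Ico_intCast ℝ (Nat.cast_injective (R := ℤ) |>.ne hmn)
    simpa [Function.onFun] using this
  rw [← Measure.restrict_iUnion hd (fun _ => measurableSet_Ico), lebPos,
    restrict_Ioi_eq_restrict_Ici]
  congr 1
  ext x
  simp only [mem_Ici, mem_iUnion, mem_Ico]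
  refine ⟨fun hx => ⟨⌊x⌋₊, Nat.floor_le hx, Nat.lt_floor_add_one x⟩, ?_⟩
  rintro ⟨n, hn, -⟩
  exact (Nat.cast_nonneg n).trans hn

/-- Each unit interval is translated by an integer, and the bijection between `ℕ` and `ℤ` makes the
images tile the line exactly once. -/
theorem measurePreserving_halfLineToLine : MeasurePreserving halfLineToLine lebPos volume := by
  refine ⟨measurable_halfLineToLine, ?_⟩
  have key : ∀ n : ℕ, Measure.map halfLineToLine (volume.restrict (Ico (n : ℝ) (n + 1))) =
      volume.restrict (Ico ((Equiv.intEquivNat.symm n : ℤ) : ℝ)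
        ((Equiv.intEquivNat.symm n : ℤ) + 1)) := by
    intro n
    rw [volume_restrict_Ico_add, volume_restrict_Ico_add,
      Measure.map_map measurable_halfLineToLine (measurable_add_const _)]
    refine Measure.map_congr ?_
    filter_upwards [ae_restrict_mem measurableSet_Ico] with x hx
    have h1 : ⌊x + n⌋₊ = n := by
      rw [Nat.floor_add_natCast hx.1, Nat.floor_eq_zero.2 hx.2, zero_add]
    simp [halfLineToLine, h1, Int.fract_eq_self.2 hx]
  rw [lebPos_eq_sum_restrict, Measure.map_sum measurable_halfLineToLine.aemeasurable]
  simp_rw [key]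
  conv_rhs => rw [volume_eq_sum_restrict]
  exact Measure.sum_comp_equiv Equiv.intEquivNat.symm
    (fun z : ℤ => (volume : Measure ℝ).restrict (Ico (z : ℝ) (z + 1)))

theorem measurePreserving_exp_halfLineToLine :
    MeasurePreserving (fun x => Real.exp (halfLineToLine x)) lebPos homPos :=
  have h : MeasurePreserving Real.exp volume homPos :=
    ⟨Real.measurable_exp, homPos_eq_map_exp.symm⟩
  h.comp measurePreserving_halfLineToLine

/-! ### Non-increasing rearrangements. -/

section Rearrangement

theorem antitone_rearrangement (μ : Measure ℝ) (f : ℝ → ℝ≥0∞) : Antitone (rearrangement μ f) :=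
  fun _ _ h => sInf_le_sInf fun _ hs => le_trans hs (ENNReal.ofReal_le_ofReal h)

theorem rearrangement_mono_ae {μ : Measure ℝ} {f g : ℝ → ℝ≥0∞} (h : f ≤ᵐ[μ] g) (t : ℝ) :
    rearrangement μ f t ≤ rearrangement μ g t := by
  refine sInf_le_sInf fun s hs => le_trans (measure_mono_ae ?_) hs
  filter_upwards [h] with x hx hs using lt_of_lt_of_le hs hx

/-- The distribution function is right-continuous: `{s < f}` is the increasing union of `{vₙ < f}`
as `vₙ` decreases to `s`. Continuity from below holds for arbitrary sets, so `f` need not be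
measurable. -/
theorem lt_rearrangement_iff {μ : Measure ℝ} {f : ℝ → ℝ≥0∞} {t : ℝ} {s : ℝ≥0∞} :
    s < rearrangement μ f t ↔ ENNReal.ofReal t < μ {x | s < f x} := by
  constructor
  · intro h
    by_contra! h'
    exact h.not_ge (sInf_le h')
  · intro h
    have hs : s ≠ ∞ := by
      rintro rfl
      simp at h
    obtain ⟨v, hv, hvs, hlim⟩ := exists_seq_strictAnti_tendsto' (lt_top_iff_ne_top.2 hs)
    have hU : {x | s < f x} = ⋃ n, {x | v n < f x} := by
      ext x
      simp only [mem_ofPred_eq, mem_iUnion]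
      refine ⟨fun hx => (hlim.eventually_lt_const hx).exists, ?_⟩
      rintro ⟨n, hn⟩
      exact (hvs n).1.trans hn
    have hm : Monotone fun n => {x | v n < f x} := fun m n hmn x hx =>
      (hv.antitone hmn).trans_lt hx
    rw [hU, hm.measure_iUnion, lt_iSup_iff] at h
    obtain ⟨n, hn⟩ := h
    refine (hvs n).1.trans_le (le_sInf fun r hr => ?_)
    by_contra! hrn
    refine (hn.trans_le (le_trans (measure_mono fun x hx => ?_) hr)).false
    exact hrn.trans hx

/-- The superlevel set of the rearrangement at height `s` is an interval starting at `0` of length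
`μ {s < f}`, so a function and its rearrangement are equimeasurable. -/
theorem rearrangement_lebPos_rearrangement (μ : Measure ℝ) (f : ℝ → ℝ≥0∞) (t : ℝ) :
    rearrangement lebPos (rearrangement μ f) t = rearrangement μ f t := by
  have h : ∀ s, lebPos {x | s < rearrangement μ f x} = μ {x | s < f x} := by
    intro s
    simp_rw [lt_rearrangement_iff]
    rw [lebPos, Measure.restrict_apply' measurableSet_Ioi]
    rcases eq_or_ne (μ {x | s < f x}) ∞ with hd | hd
    · have : {x : ℝ | ENNReal.ofReal x < μ {x | s < f x}} ∩ Ioi 0 = Ioi 0 := by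
        ext x; simp [hd]
      rw [this, hd, Real.volume_Ioi]
    · have : {x : ℝ | ENNReal.ofReal x < μ {x | s < f x}} ∩ Ioi 0 =
          Ioo 0 (μ {x | s < f x}).toReal := by
        ext x
        simp only [mem_inter_iff, mem_ofPred_eq, mem_Ioi, mem_Ioo, and_comm (b := 0 < x)]
        refine and_congr_right fun hx => ?_
        rw [ENNReal.ofReal_lt_iff_lt_toReal hx.le hd]
      rw [this, Real.volume_Ioo, sub_zero, ENNReal.ofReal_toReal hd]
  unfold rearrangement at h ⊢
  simp_rw [h]

theorem rearrangement_comp {μ ν : Measure ℝ} {φ : ℝ → ℝ} (hφ : MeasurePreserving φ μ ν)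
    {f : ℝ → ℝ≥0∞} (hf : AEMeasurable f ν) (t : ℝ) :
    rearrangement μ (fun x => f (φ x)) t = rearrangement ν f t := by
  have h : ∀ s, μ {x | s < f (φ x)} = ν {x | s < f x} := fun s =>
    hφ.measure_preimage (nullMeasurableSet_lt aemeasurable_const hf)
  simp_rw [rearrangement, h]

end Rearrangement

/-! ### R.i. norms and their copies over `dt / t`. -/

namespace RISpace

variable (E : RISpace)

theorem norm_const_mul (c : ℝ≥0∞) {f : ℝ → ℝ≥0∞} (hf : AEMeasurable f lebPos) :
    E.norm (fun t => c * f t) = c * E.norm f := by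
  induction c with
  | coe c => exact E.norm_smul c f hf
  | top =>
    -- The infinite constant is the supremum of the integers, so the Fatou property extends
    -- homogeneity to it.
    have h := E.norm_iSup (fun n t => (n : ℝ≥0∞) * f t) (fun n => hf.const_mul _)
      (fun m n hmn t => by dsimp only; gcongr)
    simp_rw [← ENNReal.iSup_mul, ENNReal.iSup_natCast] at h
    rw [h]
    have h2 : ∀ n : ℕ, E.norm (fun t => (n : ℝ≥0∞) * f t) = n * E.norm f := fun n => by
      simpa using E.norm_smul n f hf
    simp_rw [h2, ← ENNReal.iSup_mul, ENNReal.iSup_natCast]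

theorem norm_zero : E.norm (fun _ => 0) = 0 :=
  (E.norm_eq_zero_iff _ aemeasurable_const).2 (ae_eq_refl _)

theorem norm_sum_le (f : ℕ → ℝ → ℝ≥0∞) (hf : ∀ n, AEMeasurable (f n) lebPos) (n : ℕ) :
    E.norm (fun t => ∑ i ∈ Finset.range n, f i t) ≤ ∑ i ∈ Finset.range n, E.norm (f i) := by
  induction n with
  | zero => simp [norm_zero]
  | succ n ih =>
    simp_rw [Finset.sum_range_succ]
    exact (E.norm_add_le _ _ (Finset.aemeasurable_fun_sum _ fun i _ => hf i) (hf n)).trans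
      (by gcongr)

theorem norm_tsum_le (f : ℕ → ℝ → ℝ≥0∞) (hf : ∀ n, AEMeasurable (f n) lebPos) :
    E.norm (fun t => ∑' n, f n t) ≤ ∑' n, E.norm (f n) := by
  simp_rw [ENNReal.tsum_eq_iSup_nat]
  rw [E.norm_iSup _ (fun n => Finset.aemeasurable_fun_sum _ fun i _ => hf i)]
  · exact iSup_mono fun n => E.norm_sum_le f hf n
  · intro m n hmn t
    exact Finset.sum_le_sum_of_subset (Finset.range_mono hmn)

/-- The exponential is dominated by a geometric series of indicators of `[n, n + 1)`, whose norms
are bounded uniformly by rearrangement invariance. -/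
theorem norm_exp_neg_lt_top {α : ℝ} (hα : 0 < α) :
    E.norm (fun t => ENNReal.ofReal (Real.exp (-(α * t)))) < ∞ := by
  set c : ℝ≥0∞ := E.norm ((Ico (0 : ℝ) 1).indicator fun _ => 1) with hc
  have hvol : ∀ s : Set ℝ, lebPos s ≤ volume s := fun s => Measure.restrict_apply_le _ _
  have hcfin : c < ∞ := E.norm_indicator_lt_top _ measurableSet_Ico
    ((hvol _).trans_lt (by simp))
  have hshift : ∀ n : ℕ, E.norm ((Ico (n : ℝ) (n + 1)).indicator fun _ => 1) ≤ c := by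
    intro n
    refine E.norm_le_of_rearrangement_le _ _
      (aemeasurable_const.indicator measurableSet_Ico)
      (aemeasurable_const.indicator measurableSet_Ico) fun t _ => sInf_le_sInf fun s hs => ?_
    rw [mem_ofPred_eq] at hs ⊢
    rcases lt_or_ge s 1 with h1 | h1
    · have hset : ∀ A : Set ℝ, {x | s < A.indicator (fun _ => (1 : ℝ≥0∞)) x} = A := by
        intro A
        ext x
        by_cases hx : x ∈ A <;> simp [hx, h1]
      rw [hset] at hs ⊢
      refine le_trans ((hvol _).trans ?_) hs
      rw [lebPos, restrict_Ioi_eq_restrict_Ici, Measure.restrict_apply measurableSet_Ico,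
        inter_eq_left.2 (fun x hx => hx.1)]
      simp
    · have hset : {x | s < (Ico (n : ℝ) (n + 1)).indicator (fun _ => (1 : ℝ≥0∞)) x} = ∅ := by
        ext x
        simp only [mem_ofPred_eq, mem_empty_iff_false, iff_false, not_lt]
        exact (indicator_le_self' (fun _ _ => zero_le) x).trans h1
      simp [hset]
  have hle : (fun t => ENNReal.ofReal (Real.exp (-(α * t)))) ≤ᵐ[lebPos] fun t => ∑' n : ℕ,
      ENNReal.ofReal (Real.exp (-α)) ^ n * (Ico (n : ℝ) (n + 1)).indicator (fun _ => 1) t := by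
    filter_upwards [ae_restrict_mem measurableSet_Ioi] with t ht
    refine le_trans ?_ (ENNReal.le_tsum ⌊t⌋₊)
    have h1 := Nat.floor_le (le_of_lt (show (0 : ℝ) < t from ht))
    rw [indicator_of_mem (show t ∈ Ico _ _ from ⟨h1, Nat.lt_floor_add_one t⟩), mul_one,
      ← ENNReal.ofReal_pow (Real.exp_pos _).le, ← Real.exp_nat_mul]
    refine ENNReal.ofReal_le_ofReal (Real.exp_le_exp.2 ?_)
    nlinarith
  have hm : ∀ n : ℕ, AEMeasurable (fun t => ENNReal.ofReal (Real.exp (-α)) ^ n *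
      (Ico (n : ℝ) (n + 1)).indicator (fun _ => (1 : ℝ≥0∞)) t) lebPos := fun n =>
    (aemeasurable_const.indicator measurableSet_Ico).const_mul _
  calc _ ≤ _ := E.norm_mono _ _ (by fun_prop) (AEMeasurable.tsum hm) hle
    _ ≤ _ := E.norm_tsum_le _ hm
    _ ≤ ∑' n : ℕ, ENNReal.ofReal (Real.exp (-α)) ^ n * c := by
      refine ENNReal.tsum_le_tsum fun n => ?_
      rw [E.norm_const_mul _ (aemeasurable_const.indicator measurableSet_Ico)]
      gcongr
      exact hshift n
    _ < ∞ := by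
      rw [ENNReal.tsum_mul_right, ENNReal.tsum_geometric]
      refine ENNReal.mul_lt_top ?_ hcfin
      rw [ENNReal.inv_lt_top, tsub_pos_iff_lt, ENNReal.ofReal_lt_one, Real.exp_lt_one_iff]
      linarith

/-- No measurability of `f` or `g` is required: rearrangements are antitone, hence measurable. -/
theorem tildeNorm_mono {f g : ℝ → ℝ≥0∞} (h : ∀ t, 0 < t → f t ≤ g t) :
    E.tildeNorm f ≤ E.tildeNorm g :=
  E.norm_mono _ _ (antitone_rearrangement _ _).measurable.aemeasurable
    (antitone_rearrangement _ _).measurable.aemeasurable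
    (ae_of_all _ (rearrangement_mono_ae (ae_homPos_pos.mono h)))

/-- Rearrangement is not subadditive, so the triangle inequality is not visible from the definition.
Composition with a measure preserving map is linear, and this formula transfers additivity and
homogeneity from `E`. -/
theorem tildeNorm_eq {f : ℝ → ℝ≥0∞} (hf : AEMeasurable f homPos) :
    E.tildeNorm f = E.norm fun x => f (Real.exp (halfLineToLine x)) := by
  have hr := (antitone_rearrangement homPos f).measurable.aemeasurable (μ := lebPos)
  have hc := hf.comp_quasiMeasurePreserving
    measurePreserving_exp_halfLineToLine.quasiMeasurePreserving
  have h : ∀ t, rearrangement lebPos (rearrangement homPos f) t =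
      rearrangement lebPos (fun x => f (Real.exp (halfLineToLine x))) t := fun t => by
    rw [rearrangement_lebPos_rearrangement,
      rearrangement_comp measurePreserving_exp_halfLineToLine hf]
  exact le_antisymm (E.norm_le_of_rearrangement_le _ _ hr hc fun t _ => (h t).le)
    (E.norm_le_of_rearrangement_le _ _ hc hr fun t _ => (h t).ge)

theorem tildeNorm_add_le {f g : ℝ → ℝ≥0∞} (hf : AEMeasurable f homPos)
    (hg : AEMeasurable g homPos) :
    E.tildeNorm (fun t => f t + g t) ≤ E.tildeNorm f + E.tildeNorm g := by
  rw [E.tildeNorm_eq hf, E.tildeNorm_eq hg, E.tildeNorm_eq (f := fun t => f t + g t) (hf.add hg)]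
  exact E.norm_add_le _ _ (hf.comp_quasiMeasurePreserving
    measurePreserving_exp_halfLineToLine.quasiMeasurePreserving)
    (hg.comp_quasiMeasurePreserving
    measurePreserving_exp_halfLineToLine.quasiMeasurePreserving)

theorem tildeNorm_const_mul (c : ℝ≥0∞) {f : ℝ → ℝ≥0∞} (hf : AEMeasurable f homPos) :
    E.tildeNorm (fun t => c * f t) = c * E.tildeNorm f := by
  rw [E.tildeNorm_eq hf, E.tildeNorm_eq (hf.const_mul c)]
  exact E.norm_const_mul c (hf.comp_quasiMeasurePreserving
    measurePreserving_exp_halfLineToLine.quasiMeasurePreserving)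

theorem tildeNormOn_mono {I J : Set ℝ} {f g : ℝ → ℝ≥0∞}
    (h : ∀ t, 0 < t → t ∈ I → t ∈ J ∧ f t ≤ g t) :
    E.tildeNormOn I f ≤ E.tildeNormOn J g := by
  refine E.tildeNorm_mono fun t ht => ?_
  by_cases hI : t ∈ I
  · rw [indicator_of_mem hI, indicator_of_mem (h t ht hI).1]
    exact (h t ht hI).2
  · simp [hI]

theorem tildeNormOn_const_mul {I : Set ℝ} (hI : MeasurableSet I) (c : ℝ≥0∞) {f : ℝ → ℝ≥0∞}
    (hf : AEMeasurable f homPos) :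
    E.tildeNormOn I (fun t => c * f t) = c * E.tildeNormOn I f := by
  rw [tildeNormOn, tildeNormOn, ← E.tildeNorm_const_mul c (hf.indicator hI)]
  congr 1
  ext t
  by_cases h : t ∈ I <;> simp [h]

theorem tildeNormOn_add_le {I : Set ℝ} (hI : MeasurableSet I) {f g : ℝ → ℝ≥0∞}
    (hf : AEMeasurable f homPos) (hg : AEMeasurable g homPos) :
    E.tildeNormOn I (fun t => f t + g t) ≤ E.tildeNormOn I f + E.tildeNormOn I g := by
  refine le_trans (E.tildeNorm_mono fun t _ => le_of_eq ?_)
    (E.tildeNorm_add_le (hf.indicator hI) (hg.indicator hI))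
  by_cases h : t ∈ I <;> simp [h]

theorem tildeNormOn_le_add {I J L : Set ℝ} (hJ : MeasurableSet J) (hL : MeasurableSet L)
    (h : ∀ t, 0 < t → t ∈ I → t ∈ J ∪ L) {f : ℝ → ℝ≥0∞} (hf : AEMeasurable f homPos) :
    E.tildeNormOn I f ≤ E.tildeNormOn J f + E.tildeNormOn L f := by
  refine le_trans (E.tildeNorm_mono fun t ht => ?_)
    (E.tildeNorm_add_le (hf.indicator hJ) (hf.indicator hL))
  by_cases hI : t ∈ I
  · rw [indicator_of_mem hI]
    rcases h t ht hI with h | h <;> simp [h]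
  · simp [hI]

/-- In logarithmic scale the power is an exponential: its superlevel set at height `exp (-αt)` lies
in `[u, u e^t)`, of `dt / t`-measure `t`. The bound is therefore independent of `u`. -/
theorem tildeNormOn_Ici_rpow_le {α u : ℝ} (hα : 0 < α) (hu : 0 < u) :
    E.tildeNormOn (Ici u) (fun s => ENNReal.ofReal ((s / u) ^ (-α))) ≤
      E.norm fun t => ENNReal.ofReal (Real.exp (-(α * t))) := by
  refine E.norm_mono _ _ (antitone_rearrangement _ _).measurable.aemeasurable (by fun_prop) ?_
  filter_upwards [ae_restrict_mem measurableSet_Ioi] with t ht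
  refine sInf_le ?_
  have ht' : (0 : ℝ) < t := ht
  have hsub : {x | ENNReal.ofReal (Real.exp (-(α * t))) <
      (Ici u).indicator (fun s => ENNReal.ofReal ((s / u) ^ (-α))) x} ⊆
      {u} ∪ Ioo u (u * Real.exp t) := by
    intro x hx
    by_cases hxu : u ≤ x
    · rcases hxu.eq_or_lt with rfl | hlt
      · simp
      · refine Or.inr ⟨hlt, ?_⟩
        rw [mem_ofPred_eq, indicator_of_mem (show x ∈ Ici u from hxu)] at hx
        have hx0 : 0 < x / u := div_pos (hu.trans hlt) hu
        have h1 := (ENNReal.ofReal_lt_ofReal_iff_of_nonneg (Real.exp_pos _).le).1 hx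
        rw [Real.rpow_def_of_pos hx0, Real.exp_lt_exp] at h1
        have h2 : Real.log (x / u) < t := by nlinarith
        rwa [Real.log_lt_iff_lt_exp hx0, div_lt_iff₀ hu, mul_comm] at h2
    · simp [hxu] at hx
  refine (measure_mono hsub).trans ((measure_union_le _ _).trans ?_)
  rw [measure_singleton, zero_add, homPos_Ioo hu (le_mul_of_one_le_right hu.le
    (Real.one_le_exp ht'.le)), mul_div_cancel_left₀ _ hu.ne', Real.log_exp]

theorem tildeNormOn_Ioc_rpow_le {α u : ℝ} (hα : 0 < α) (hu : 0 < u) :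
    E.tildeNormOn (Ioc 0 u) (fun s => ENNReal.ofReal ((s / u) ^ α)) ≤
      E.norm fun t => ENNReal.ofReal (Real.exp (-(α * t))) := by
  refine E.norm_mono _ _ (antitone_rearrangement _ _).measurable.aemeasurable (by fun_prop) ?_
  filter_upwards [ae_restrict_mem measurableSet_Ioi] with t ht
  refine sInf_le ?_
  have ht' : (0 : ℝ) < t := ht
  have hsub : {x | ENNReal.ofReal (Real.exp (-(α * t))) <
      (Ioc 0 u).indicator (fun s => ENNReal.ofReal ((s / u) ^ α)) x} ⊆
      {u} ∪ Ioo (u * Real.exp (-t)) u := by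
    intro x hx
    by_cases hxu : x ∈ Ioc 0 u
    · rcases hxu.2.eq_or_lt with rfl | hlt
      · simp
      · refine Or.inr ⟨?_, hlt⟩
        rw [mem_ofPred_eq, indicator_of_mem hxu] at hx
        have hx0 : 0 < x / u := div_pos hxu.1 hu
        have h1 := (ENNReal.ofReal_lt_ofReal_iff_of_nonneg (Real.exp_pos _).le).1 hx
        rw [Real.rpow_def_of_pos hx0, Real.exp_lt_exp] at h1
        have h2 : -t < Real.log (x / u) := by nlinarith
        rwa [Real.lt_log_iff_exp_lt hx0, lt_div_iff₀ hu, mul_comm] at h2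
    · simp [hxu] at hx
  refine (measure_mono hsub).trans ((measure_union_le _ _).trans ?_)
  rw [measure_singleton, zero_add, homPos_Ioo (by positivity) (mul_le_of_le_one_right hu.le
    (Real.exp_le_one_iff.2 (by linarith)))]
  rw [← div_div, div_self hu.ne', one_div, ← Real.exp_neg, neg_neg, Real.log_exp]

/-- Every interval `(u, 2u)` has `dt / t`-measure `log 2`, so the inverse norm of the indicator of
`(0, log 2)` serves for all `u`. This turns norm bounds into pointwise bounds. -/
theorem exists_le_mul_tildeNormOn_Ioo : ∃ C : ℝ≥0, ∀ (u : ℝ), 0 < u → ∀ (M : ℝ≥0∞)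
    (w : ℝ → ℝ≥0∞), (∀ s ∈ Ioo u (2 * u), M ≤ w s) →
      M ≤ C * E.tildeNormOn (Ioo u (2 * u)) w := by
  set S : Set ℝ := Ioo 0 (Real.log 2)
  set m : ℝ≥0∞ := E.norm (S.indicator fun _ => 1)
  have hlog : 0 < Real.log 2 := Real.log_pos one_lt_two
  have hS : lebPos S = ENNReal.ofReal (Real.log 2) := by
    rw [lebPos, Measure.restrict_apply measurableSet_Ioo, inter_eq_left.2 Ioo_subset_Ioi_self,
      Real.volume_Ioo, sub_zero]
  have hmeas : AEMeasurable (S.indicator fun _ => (1 : ℝ≥0∞)) lebPos :=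
    aemeasurable_const.indicator measurableSet_Ioo
  have hm : m ≠ ∞ := (E.norm_indicator_lt_top S measurableSet_Ioo (by simp [hS])).ne
  have hm0 : m ≠ 0 := by
    intro h
    rw [E.norm_eq_zero_iff _ hmeas, indicator_ae_eq_zero] at h
    rw [inter_eq_left.2 fun x _ => by simp, hS] at h
    simp [hlog.not_ge] at h
  refine ⟨m⁻¹.toNNReal, fun u hu M w hw => ?_⟩
  rw [ENNReal.coe_toNNReal (ENNReal.inv_ne_top.2 hm0)]
  have h1 : M * m ≤ E.tildeNormOn (Ioo u (2 * u)) w := by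
    rw [← E.norm_const_mul M hmeas]
    refine E.norm_mono _ _ (hmeas.const_mul M)
      (antitone_rearrangement _ _).measurable.aemeasurable (ae_of_all _ fun t => ?_)
    by_cases ht : t ∈ S
    · simp only [indicator_of_mem ht, mul_one]
      refine le_sInf fun s hs => ?_
      by_contra! hsM
      have h2 : homPos (Ioo u (2 * u)) ≤ ENNReal.ofReal t := by
        refine (measure_mono fun x hx => ?_).trans hs
        rw [mem_ofPred_eq, indicator_of_mem hx]
        exact hsM.trans_le (hw x hx)
      rw [homPos_Ioo hu (by linarith), mul_div_cancel_right₀ _ hu.ne',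
        ENNReal.ofReal_le_ofReal_iff ht.1.le] at h2
      exact h2.not_gt ht.2
    · simp [ht]
  calc M = m⁻¹ * (M * m) := by
        rw [mul_left_comm, ENNReal.inv_mul_cancel hm0 hm, mul_one]
    _ ≤ _ := by gcongr

end RISpace

/-! ### Slowly varying weights. -/

/-- Positive functions on `(0, ∞)` growing and decaying slower than every power, in the form of a
two-point estimate. -/
structure PowerBounded (b : ℝ → ℝ) : Prop where
  pos : ∀ t, 0 < t → 0 < b t
  bound : ∀ ε : ℝ, 0 < ε → ∃ C : ℝ, 0 < C ∧ ∀ s t, 0 < s → 0 < t →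
    b s ≤ C * max (s / t) (t / s) ^ ε * b t

theorem max_div_pos {s t : ℝ} (hs : 0 < s) (ht : 0 < t) : 0 < max (s / t) (t / s) :=
  lt_max_of_lt_left (div_pos hs ht)

theorem SlowlyVarying.powerBounded {b : ℝ → ℝ} (hb : SlowlyVarying b) : PowerBounded b := by
  refine ⟨hb.pos, fun ε hε => ?_⟩
  obtain ⟨φ, hφ, C, hC, h⟩ := hb.equiv_monotone ε hε
  obtain ⟨ψ, hψ, D, hD, h'⟩ := hb.equiv_antitone ε hε
  refine ⟨C * C + D * D, by positivity, fun s t hs ht => ?_⟩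
  have hbt := hb.pos t ht
  rcases le_total s t with hst | hst
  · have h1 : s ^ ε * b s ≤ C * (C * (t ^ ε * b t)) :=
      (h s hs).1.trans (by gcongr; exact (hφ hs ht hst).trans (h t ht).2)
    have h2 : b s ≤ C * C * (t / s) ^ ε * b t := by
      rw [Real.div_rpow ht.le hs.le]
      have := Real.rpow_pos_of_pos hs ε
      rw [mul_div_assoc', div_mul_eq_mul_div, le_div_iff₀ this]
      linarith
    refine h2.trans ?_
    gcongr
    · nlinarith
    · exact le_max_right _ _
  · have h1 : s ^ (-ε) * b s ≤ D * (D * (t ^ (-ε) * b t)) :=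
      (h' s hs).1.trans (by gcongr; exact (hψ ht hs hst).trans (h' t ht).2)
    have h2 : b s ≤ D * D * (s / t) ^ ε * b t := by
      rw [Real.div_rpow hs.le ht.le]
      have h3 := Real.rpow_pos_of_pos hs ε
      have h4 := Real.rpow_pos_of_pos ht ε
      rw [Real.rpow_neg hs.le, Real.rpow_neg ht.le] at h1
      rw [mul_div_assoc', div_mul_eq_mul_div, le_div_iff₀ h4]
      field_simp at h1
      linarith
    refine h2.trans ?_
    gcongr
    · nlinarith
    · exact le_max_left _ _

namespace PowerBounded

variable {a b : ℝ → ℝ}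

theorem mul (ha : PowerBounded a) (hb : PowerBounded b) : PowerBounded fun t => a t * b t := by
  refine ⟨fun t ht => mul_pos (ha.pos t ht) (hb.pos t ht), fun ε hε => ?_⟩
  obtain ⟨C, hC, h⟩ := ha.bound (ε / 2) (by positivity)
  obtain ⟨D, hD, h'⟩ := hb.bound (ε / 2) (by positivity)
  refine ⟨C * D, by positivity, fun s t hs ht => ?_⟩
  have hm := max_div_pos hs ht
  calc a s * b s ≤ (C * max (s / t) (t / s) ^ (ε / 2) * a t) *
        (D * max (s / t) (t / s) ^ (ε / 2) * b t) :=
        mul_le_mul (h s t hs ht) (h' s t hs ht) (hb.pos s hs).le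
          ((ha.pos s hs).le.trans (h s t hs ht))
    _ = C * D * (max (s / t) (t / s) ^ (ε / 2) * max (s / t) (t / s) ^ (ε / 2)) *
        (a t * b t) := by ring
    _ = _ := by rw [← Real.rpow_add hm, add_halves]

theorem inv (ha : PowerBounded a) : PowerBounded fun t => (a t)⁻¹ := by
  refine ⟨fun t ht => inv_pos.2 (ha.pos t ht), fun ε hε => ?_⟩
  obtain ⟨C, hC, h⟩ := ha.bound ε hε
  refine ⟨C, hC, fun s t hs ht => ?_⟩
  have h1 := h t s ht hs
  rw [max_comm] at h1
  rw [← div_eq_mul_inv, le_div_iff₀ (ha.pos t ht), inv_mul_le_iff₀ (ha.pos s hs)]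
  linarith

theorem div (ha : PowerBounded a) (hb : PowerBounded b) : PowerBounded fun t => a t / b t := by
  simpa only [div_eq_mul_inv] using ha.mul hb.inv

theorem exists_le_of_le_two_mul (hb : PowerBounded b) (γ : ℝ) : ∃ C : ℝ≥0, ∀ s t, 0 < s → 0 < t →
    s ≤ 2 * t → t ≤ 2 * s →
      ENNReal.ofReal (s ^ γ * b s) ≤ C * ENNReal.ofReal (t ^ γ * b t) := by
  obtain ⟨C, hC, h⟩ := hb.bound 1 one_pos
  refine ⟨(2 ^ |γ| * (C * 2)).toNNReal, fun s t hs ht hst hts => ?_⟩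
  rw [← ENNReal.ofReal, ← ENNReal.ofReal_mul (by positivity)]
  refine ENNReal.ofReal_le_ofReal ?_
  have hbt := hb.pos t ht
  have hm : max (s / t) (t / s) ≤ 2 := max_le ((div_le_iff₀ ht).2 hst) ((div_le_iff₀ hs).2 hts)
  have h1 : b s ≤ C * 2 * b t := (h s t hs ht).trans (by rw [Real.rpow_one]; gcongr)
  have h2 : s ^ γ ≤ 2 ^ |γ| * t ^ γ := by
    rw [← div_le_iff₀ (by positivity), ← Real.div_rpow hs.le ht.le]
    rcases le_total 0 γ with hγ | hγ
    · rw [abs_of_nonneg hγ]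
      exact Real.rpow_le_rpow (by positivity) ((div_le_iff₀ ht).2 hst) hγ
    · rw [abs_of_nonpos hγ, ← inv_div, Real.inv_rpow (by positivity), ← Real.rpow_neg (by positivity)]
      exact Real.rpow_le_rpow (by positivity) ((div_le_iff₀ hs).2 hts) (by linarith)
  calc s ^ γ * b s ≤ (2 ^ |γ| * t ^ γ) * (C * 2 * b t) :=
        mul_le_mul h2 h1 (hb.pos s hs).le (by positivity)
    _ = _ := by ring

/-- Half of the exponent `α` absorbs the variation of `b` between `u` and `s`; the other half leaves
a decaying power of `s / u`, whose norm is bounded uniformly in `u`. -/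
theorem exists_tildeNormOn_Ici_le (hb : PowerBounded b) (E : RISpace) {α : ℝ} (hα : 0 < α) :
    ∃ C : ℝ≥0, ∀ (u : ℝ), 0 < u → ∀ (M : ℝ≥0∞) (w : ℝ → ℝ≥0∞),
      (∀ s, u ≤ s → w s ≤ M * ENNReal.ofReal (s ^ (-α) * b s)) →
        E.tildeNormOn (Ici u) w ≤ C * (M * ENNReal.ofReal (u ^ (-α) * b u)) := by
  obtain ⟨C, hC, h⟩ := hb.bound (α / 2) (by positivity)
  set P := E.norm fun t => ENNReal.ofReal (Real.exp (-(α / 2 * t)))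
  have hP : P ≠ ∞ := (E.norm_exp_neg_lt_top (half_pos hα)).ne
  refine ⟨C.toNNReal * P.toNNReal, fun u hu M w hw => ?_⟩
  rw [ENNReal.coe_mul, ENNReal.coe_toNNReal hP, ← ENNReal.ofReal]
  have hle : ∀ s, u ≤ s → w s ≤ M * ENNReal.ofReal (C * (u ^ (-α) * b u)) *
      ENNReal.ofReal ((s / u) ^ (-(α / 2))) := by
    intro s hus
    have hs := hu.trans_le hus
    have hbu := hb.pos u hu
    refine (hw s hus).trans ?_
    rw [mul_assoc, ← ENNReal.ofReal_mul (by positivity)]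
    gcongr M * ENNReal.ofReal ?_
    have h1 := h s u hs hu
    rw [max_eq_left (by rw [div_le_div_iff₀ hs hu]; nlinarith)] at h1
    calc s ^ (-α) * b s ≤ s ^ (-α) * (C * (s / u) ^ (α / 2) * b u) := by gcongr
      _ = C * ((s ^ (-α) * (s / u) ^ (α / 2)) * b u) := by ring
      _ = C * ((u ^ (-α) * (s / u) ^ (-(α / 2))) * b u) := by
        have : s ^ (-α) = u ^ (-α) * (s / u) ^ (-α) := by
          rw [← Real.mul_rpow hu.le (by positivity), mul_div_cancel₀ _ hu.ne']
        rw [this, mul_assoc (u ^ (-α)), ← Real.rpow_add (by positivity),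
          show -α + α / 2 = -(α / 2) by ring]
      _ = _ := by ring
  calc E.tildeNormOn (Ici u) w ≤ E.tildeNormOn (Ici u) fun s =>
        M * ENNReal.ofReal (C * (u ^ (-α) * b u)) * ENNReal.ofReal ((s / u) ^ (-(α / 2))) :=
        E.tildeNormOn_mono fun s _ hs => ⟨hs, hle s hs⟩
    _ = M * ENNReal.ofReal (C * (u ^ (-α) * b u)) * _ :=
        E.tildeNormOn_const_mul measurableSet_Ici _ (by fun_prop)
    _ ≤ M * ENNReal.ofReal (C * (u ^ (-α) * b u)) * P := by
        gcongr
        exact E.tildeNormOn_Ici_rpow_le (half_pos hα) hu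
    _ = _ := by rw [ENNReal.ofReal_mul hC.le]; ring

theorem exists_tildeNormOn_Ioc_le (hb : PowerBounded b) (E : RISpace) {α : ℝ} (hα : 0 < α) :
    ∃ C : ℝ≥0, ∀ (u : ℝ), 0 < u → ∀ (M : ℝ≥0∞) (w : ℝ → ℝ≥0∞),
      (∀ s, 0 < s → s ≤ u → w s ≤ M * ENNReal.ofReal (s ^ α * b s)) →
        E.tildeNormOn (Ioc 0 u) w ≤ C * (M * ENNReal.ofReal (u ^ α * b u)) := by
  obtain ⟨C, hC, h⟩ := hb.bound (α / 2) (by positivity)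
  set P := E.norm fun t => ENNReal.ofReal (Real.exp (-(α / 2 * t)))
  have hP : P ≠ ∞ := (E.norm_exp_neg_lt_top (half_pos hα)).ne
  refine ⟨C.toNNReal * P.toNNReal, fun u hu M w hw => ?_⟩
  rw [ENNReal.coe_mul, ENNReal.coe_toNNReal hP, ← ENNReal.ofReal]
  have hle : ∀ s, 0 < s → s ≤ u → w s ≤ M * ENNReal.ofReal (C * (u ^ α * b u)) *
      ENNReal.ofReal ((s / u) ^ (α / 2)) := by
    intro s hs hsu
    have hbu := hb.pos u hu
    refine (hw s hs hsu).trans ?_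
    rw [mul_assoc, ← ENNReal.ofReal_mul (by positivity)]
    gcongr M * ENNReal.ofReal ?_
    have h1 := h s u hs hu
    rw [max_eq_right (by rw [div_le_div_iff₀ hu hs]; nlinarith)] at h1
    calc s ^ α * b s ≤ s ^ α * (C * (u / s) ^ (α / 2) * b u) := by gcongr
      _ = C * ((s ^ α * (u / s) ^ (α / 2)) * b u) := by ring
      _ = C * ((u ^ α * (s / u) ^ (α / 2)) * b u) := by
        have h2 : s ^ α = u ^ α * (s / u) ^ α := by
          rw [← Real.mul_rpow hu.le (by positivity), mul_div_cancel₀ _ hu.ne']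
        have h3 : (u / s) ^ (α / 2) = (s / u) ^ (-(α / 2)) := by
          rw [Real.rpow_neg (by positivity), ← Real.inv_rpow (by positivity), inv_div]
        rw [h2, h3, mul_assoc (u ^ α), ← Real.rpow_add (by positivity),
          show α + -(α / 2) = α / 2 by ring]
      _ = _ := by ring
  calc E.tildeNormOn (Ioc 0 u) w ≤ E.tildeNormOn (Ioc 0 u) fun s =>
        M * ENNReal.ofReal (C * (u ^ α * b u)) * ENNReal.ofReal ((s / u) ^ (α / 2)) :=
        E.tildeNormOn_mono fun s _ hs => ⟨hs, hle s hs.1 hs.2⟩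
    _ = M * ENNReal.ofReal (C * (u ^ α * b u)) * _ :=
        E.tildeNormOn_const_mul measurableSet_Ioc _ (by fun_prop)
    _ ≤ M * ENNReal.ofReal (C * (u ^ α * b u)) * P := by
        gcongr
        exact E.tildeNormOn_Ioc_rpow_le (half_pos hα) hu
    _ = _ := by rw [ENNReal.ofReal_mul hC.le]; ring

/-- On `(u / 2, u)` the function `b` is comparable to `b u`, and that interval alone has norm
bounded below. -/
theorem exists_le_tildeNormOn_Ioo (hb : PowerBounded b) (E : RISpace) : ∃ C : ℝ≥0, ∀ u, 0 < u →
    ENNReal.ofReal (b u) ≤ C * E.tildeNormOn (Ioo 0 u) fun t => ENNReal.ofReal (b t) := by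
  obtain ⟨C, hC⟩ := E.exists_le_mul_tildeNormOn_Ioo
  obtain ⟨D, hD⟩ := hb.exists_le_of_le_two_mul 0
  refine ⟨D * C, fun u hu => ?_⟩
  simp only [Real.rpow_zero, one_mul] at hD
  have h := hC (u / 2) (half_pos hu) (ENNReal.ofReal (b u) / D) (fun t => ENNReal.ofReal (b t))
    fun s hs => ENNReal.div_le_of_le_mul' (hD u s hu ((half_pos hu).trans hs.1)
      (by linarith [hs.1]) (by linarith [hs.2]))
  have hD0 : (D : ℝ≥0∞) ≠ 0 := by
    intro h0
    have := hD u u hu hu (by linarith) (by linarith)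
    simp [h0, (hb.pos u hu).not_ge] at this
  rw [ENNReal.div_le_iff_le_mul (Or.inl hD0) (Or.inl ENNReal.coe_ne_top)] at h
  refine h.trans ?_
  rw [ENNReal.coe_mul, mul_comm, mul_assoc]
  gcongr
  exact E.tildeNormOn_mono fun t ht hI => ⟨⟨ht, by linarith [hI.2]⟩, le_rfl⟩

theorem exists_le_tildeNormOn_Ioi (hb : PowerBounded b) (E : RISpace) : ∃ C : ℝ≥0, ∀ u, 0 < u →
    ENNReal.ofReal (b u) ≤ C * E.tildeNormOn (Ioi u) fun t => ENNReal.ofReal (b t) := by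
  obtain ⟨C, hC⟩ := E.exists_le_mul_tildeNormOn_Ioo
  obtain ⟨D, hD⟩ := hb.exists_le_of_le_two_mul 0
  refine ⟨D * C, fun u hu => ?_⟩
  simp only [Real.rpow_zero, one_mul] at hD
  have h := hC u hu (ENNReal.ofReal (b u) / D) (fun t => ENNReal.ofReal (b t))
    fun s hs => ENNReal.div_le_of_le_mul' (hD u s hu (hu.trans hs.1)
      (by linarith [hs.1]) (by linarith [hs.2]))
  have hD0 : (D : ℝ≥0∞) ≠ 0 := by
    intro h0
    have := hD u u hu hu (by linarith) (by linarith)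
    simp [h0, (hb.pos u hu).not_ge] at this
  rw [ENNReal.div_le_iff_le_mul (Or.inl hD0) (Or.inl ENNReal.coe_ne_top)] at h
  refine h.trans ?_
  rw [ENNReal.coe_mul, mul_comm, mul_assoc]
  gcongr
  exact E.tildeNormOn_mono fun t ht hI => ⟨hI.1, le_rfl⟩

theorem exists_tildeNormOn_Icc_le (hb : PowerBounded b) (E : RISpace) : ∃ C : ℝ≥0,
    ∀ p q, 0 < p → p ≤ q → E.tildeNormOn (Icc p q) (fun t => ENNReal.ofReal (b t)) ≤
      C * (ENNReal.ofReal (q / p) * ENNReal.ofReal (b q)) := by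
  obtain ⟨C, hC⟩ := hb.exists_tildeNormOn_Ioc_le E one_pos
  refine ⟨C, fun p q hp hpq => ?_⟩
  have hq := hp.trans_le hpq
  -- On `[p, q]` one has `1 ≤ t / p`, which supplies the positive power of `t` needed for the
  -- endpoint estimate.
  have h := hC q hq (ENNReal.ofReal p⁻¹) ((Icc p q).indicator fun t => ENNReal.ofReal (b t)) ?_
  · refine le_trans (E.tildeNormOn_mono (J := Ioc 0 q) fun t ht hI => ⟨⟨ht, hI.2⟩, ?_⟩) (h.trans_eq ?_)
    · rw [indicator_of_mem hI]
    · rw [Real.rpow_one, ENNReal.ofReal_mul hq.le, ← mul_assoc (ENNReal.ofReal p⁻¹),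
        ← ENNReal.ofReal_mul (by positivity), inv_mul_eq_div]
  · intro s hs hsq
    by_cases hI : s ∈ Icc p q
    · have hbs := hb.pos s hs
      rw [indicator_of_mem hI, ← ENNReal.ofReal_mul (by positivity), Real.rpow_one, ← mul_assoc]
      refine ENNReal.ofReal_le_ofReal (le_mul_of_one_le_left hbs.le ?_)
      rw [inv_mul_eq_div, one_le_div hp]
      exact hI.1
    · simp [hI]

/-- The added piece `[u, 2u]` contributes about `b u`, which the norm over `(0, u)` already
dominates. -/
theorem exists_tildeNormOn_Ioo_two_mul_le (hb : PowerBounded b) (hbm : AEMeasurable b homPos)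
    (E : RISpace) : ∃ C : ℝ≥0, ∀ u, 0 < u →
      E.tildeNormOn (Ioo 0 (2 * u)) (fun t => ENNReal.ofReal (b t)) ≤
        C * E.tildeNormOn (Ioo 0 u) fun t => ENNReal.ofReal (b t) := by
  obtain ⟨C, hC⟩ := hb.exists_tildeNormOn_Icc_le E
  obtain ⟨D, hD⟩ := hb.exists_le_of_le_two_mul 0
  obtain ⟨A, hA⟩ := hb.exists_le_tildeNormOn_Ioo E
  refine ⟨1 + C * 2 * D * A, fun u hu => ?_⟩
  simp only [Real.rpow_zero, one_mul] at hD
  have h2 : E.tildeNormOn (Icc u (2 * u)) (fun t => ENNReal.ofReal (b t)) ≤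
      C * 2 * D * A * E.tildeNormOn (Ioo 0 u) fun t => ENNReal.ofReal (b t) := by
    refine (hC u (2 * u) hu (by linarith)).trans ?_
    rw [mul_div_cancel_right₀ _ hu.ne', ENNReal.ofReal_ofNat]
    simp only [mul_assoc]
    gcongr
    refine (hD (2 * u) u (by linarith) hu le_rfl (by linarith)).trans ?_
    gcongr
    exact hA u hu
  calc _ ≤ _ + _ := E.tildeNormOn_le_add (J := Ioo 0 u) (L := Icc u (2 * u)) measurableSet_Ioo
        measurableSet_Icc (fun t ht hI => ?_) hbm.ennreal_ofReal
    _ ≤ _ := by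
      push_cast
      rw [add_mul, one_mul]
      gcongr
  rcases lt_or_ge t u with h | h
  · exact Or.inl ⟨ht, h⟩
  · exact Or.inr ⟨h, hI.2.le⟩

theorem tildeNormOn_Icc_lt_top (hb : PowerBounded b) (E : RISpace) {p q : ℝ} (hp : 0 < p)
    (hpq : p ≤ q) : E.tildeNormOn (Icc p q) (fun t => ENNReal.ofReal (b t)) < ∞ := by
  obtain ⟨C, hC⟩ := hb.exists_tildeNormOn_Icc_le E
  exact (hC p q hp hpq).trans_lt (by finiteness)

theorem tildeNormOn_Ioo_ne_top (hb : PowerBounded b) (hbm : AEMeasurable b homPos) (E : RISpace)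
    (h : E.tildeNormOn (Ioo 0 1) (fun t => ENNReal.ofReal (b t)) < ∞) (u : ℝ) :
    E.tildeNormOn (Ioo 0 u) (fun t => ENNReal.ofReal (b t)) ≠ ∞ := by
  refine ((E.tildeNormOn_le_add (J := Ioo 0 1) (L := Icc 1 (max 1 u)) measurableSet_Ioo
    measurableSet_Icc (fun t ht hI => ?_) hbm.ennreal_ofReal).trans_lt (ENNReal.add_lt_top.2
      ⟨h, hb.tildeNormOn_Icc_lt_top E one_pos (le_max_left _ _)⟩)).ne
  rcases lt_or_ge t 1 with h | h
  · exact Or.inl ⟨ht, h⟩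
  · exact Or.inr ⟨h, hI.2.le.trans (le_max_right _ _)⟩

theorem tildeNormOn_Ioi_ne_top (hb : PowerBounded b) (hbm : AEMeasurable b homPos) (E : RISpace)
    (h : E.tildeNormOn (Ioi 1) (fun t => ENNReal.ofReal (b t)) < ∞) {u : ℝ} (hu : 0 < u) :
    E.tildeNormOn (Ioi u) (fun t => ENNReal.ofReal (b t)) ≠ ∞ := by
  refine ((E.tildeNormOn_le_add (J := Ioi 1) (L := Icc (min 1 u) 1) measurableSet_Ioi
    measurableSet_Icc (fun t ht hI => ?_) hbm.ennreal_ofReal).trans_lt (ENNReal.add_lt_top.2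
      ⟨h, hb.tildeNormOn_Icc_lt_top E (lt_min one_pos hu) (min_le_left _ _)⟩)).ne
  rcases lt_or_ge 1 t with h | h
  · exact Or.inl h
  · exact Or.inr ⟨(min_le_right _ _).trans (le_of_lt hI), h⟩

end PowerBounded

/-! ### Iterated norms of quasi-concave functions. -/

/-- The monotonicity properties of `K`-functionals: `k` is nondecreasing and `k(t) / t` is
nonincreasing on `(0, ∞)`. -/
structure QuasiConcave (k : ℝ → ℝ≥0∞) : Prop where
  mono : Monotone k
  ofReal_mul_le : ∀ s t, 0 < s → s ≤ t → ENNReal.ofReal s * k t ≤ ENNReal.ofReal t * k s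

/-- The function `s ↦ s^(-θ) a(s) k(s)`. -/
def powerWeight (θ : ℝ) (a : ℝ → ℝ) (k : ℝ → ℝ≥0∞) (s : ℝ) : ℝ≥0∞ :=
  ENNReal.ofReal (s ^ (-θ) * a s) * k s

theorem aemeasurable_powerWeight (θ : ℝ) {a : ℝ → ℝ} (ha : AEMeasurable a homPos)
    {k : ℝ → ℝ≥0∞} (hk : Monotone k) : AEMeasurable (powerWeight θ a k) homPos := by
  unfold powerWeight
  have h : Measurable fun s : ℝ => s ^ (-θ) := by fun_prop
  exact (h.aemeasurable.mul ha).ennreal_ofReal.mul hk.measurable.aemeasurable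

theorem QuasiConcave.le_two_mul {k : ℝ → ℝ≥0∞} (hk : QuasiConcave k) {s t : ℝ} (hs : 0 < s)
    (hts : t ≤ 2 * s) : k t ≤ 2 * k s := by
  rcases le_total s t with hst | hst
  · have h := hk.ofReal_mul_le s t hs hst
    have h2 : ENNReal.ofReal t ≤ ENNReal.ofReal s * 2 := by
      rw [← ENNReal.ofReal_ofNat 2, ← ENNReal.ofReal_mul hs.le]
      exact ENNReal.ofReal_le_ofReal (by linarith)
    have h3 : ENNReal.ofReal s * k t ≤ ENNReal.ofReal s * (2 * k s) :=
      h.trans (by rw [← mul_assoc]; gcongr)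
    exact (ENNReal.mul_le_mul_iff_right (by simpa using hs) ENNReal.ofReal_ne_top).1 h3
  · exact (hk.mono hst).trans (le_mul_of_one_le_left zero_le one_le_two)

namespace RISpace

variable (E F : RISpace) {θ : ℝ} {a b : ℝ → ℝ}

/-- The iterated norm `‖ b(t) ‖ s^(-θ) a(s) k(s) ‖_{F̃(J(t))} ‖_{Ẽ(I)}`. -/
def iterNorm (I : Set ℝ) (J : ℝ → Set ℝ) (θ : ℝ) (b a : ℝ → ℝ) (k : ℝ → ℝ≥0∞) : ℝ≥0∞ :=
  E.tildeNormOn I fun t => ENNReal.ofReal (b t) * F.tildeNormOn (J t) (powerWeight θ a k)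

theorem measurable_tildeNormOn_of_monotone {J : ℝ → Set ℝ} (hJ : Monotone J) (w : ℝ → ℝ≥0∞) :
    Measurable fun t => F.tildeNormOn (J t) w :=
  Monotone.measurable fun _ _ h => F.tildeNormOn_mono fun _ _ hx => ⟨hJ h hx, le_rfl⟩

theorem measurable_tildeNormOn_of_antitone {J : ℝ → Set ℝ} (hJ : Antitone J) (w : ℝ → ℝ≥0∞) :
    Measurable fun t => F.tildeNormOn (J t) w :=
  Antitone.measurable fun _ _ h => F.tildeNormOn_mono fun _ _ hx => ⟨hJ h hx, le_rfl⟩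

theorem aemeasurable_mul_of_measurable (hb : AEMeasurable b homPos) {G : ℝ → ℝ≥0∞}
    (hG : Measurable G) : AEMeasurable (fun t => ENNReal.ofReal (b t) * G t) homPos :=
  hb.ennreal_ofReal.mul hG.aemeasurable

/-- Subadditivity of the iterated norm in `k`. -/
theorem iterNorm_le_of_le_add {I : Set ℝ} {J : ℝ → Set ℝ} (hI : MeasurableSet I)
    (hJ : ∀ t, MeasurableSet (J t)) (hJm : ∀ w, Measurable fun t => F.tildeNormOn (J t) w)
    (ha : AEMeasurable a homPos) (hb : AEMeasurable b homPos) {k k₁ k₂ : ℝ → ℝ≥0∞}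
    (hk₁ : Monotone k₁) (hk₂ : Monotone k₂) {c : ℝ≥0∞} (h : ∀ s, k s ≤ c * (k₁ s + k₂ s)) :
    iterNorm E F I J θ b a k ≤
      c * (iterNorm E F I J θ b a k₁ + iterNorm E F I J θ b a k₂) := by
  have hw₁ := aemeasurable_powerWeight θ ha hk₁
  have hw₂ := aemeasurable_powerWeight θ ha hk₂
  have hin : ∀ t, F.tildeNormOn (J t) (powerWeight θ a k) ≤
      c * (F.tildeNormOn (J t) (powerWeight θ a k₁) +
        F.tildeNormOn (J t) (powerWeight θ a k₂)) := by
    intro t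
    calc _ ≤ F.tildeNormOn (J t) fun s => c * (powerWeight θ a k₁ s + powerWeight θ a k₂ s) :=
          F.tildeNormOn_mono fun s _ hs => ⟨hs, by
            unfold powerWeight
            rw [← mul_add, mul_left_comm]
            gcongr
            exact h s⟩
      _ = c * _ := F.tildeNormOn_const_mul (hJ t) c (hw₁.add hw₂)
      _ ≤ _ := by
          gcongr
          exact F.tildeNormOn_add_le (hJ t) hw₁ hw₂
  have hm₁ := hb.ennreal_ofReal.mul (hJm (powerWeight θ a k₁)).aemeasurable
  have hm₂ := hb.ennreal_ofReal.mul (hJm (powerWeight θ a k₂)).aemeasurable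
  calc _ ≤ E.tildeNormOn I fun t =>
        c * (ENNReal.ofReal (b t) * F.tildeNormOn (J t) (powerWeight θ a k₁) +
          ENNReal.ofReal (b t) * F.tildeNormOn (J t) (powerWeight θ a k₂)) :=
        E.tildeNormOn_mono fun t _ ht => ⟨ht, by
          rw [← mul_add, mul_left_comm]
          gcongr
          exact hin t⟩
    _ = c * _ := E.tildeNormOn_const_mul hI c (hm₁.add hm₂)
    _ ≤ _ := by
        gcongr
        exact E.tildeNormOn_add_le hI hm₁ hm₂

theorem mul_iterNorm_le {I L : Set ℝ} {J : ℝ → Set ℝ} (hI : MeasurableSet I)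
    (hJm : ∀ w, Measurable fun t => F.tildeNormOn (J t) w) (hJL : ∀ t, 0 < t → t ∈ I → J t ⊆ L)
    (hb : AEMeasurable b homPos) {k : ℝ → ℝ≥0∞} {p q : ℝ≥0∞}
    (h : p * F.tildeNormOn L (powerWeight θ a k) ≤ q) :
    p * iterNorm E F I J θ b a k ≤ q * E.tildeNormOn I fun t => ENNReal.ofReal (b t) := by
  rw [iterNorm, ← E.tildeNormOn_const_mul hI _ (aemeasurable_mul_of_measurable hb (hJm _)),
    ← E.tildeNormOn_const_mul hI _ hb.ennreal_ofReal]
  refine E.tildeNormOn_mono fun t ht hI => ⟨hI, ?_⟩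
  rw [mul_left_comm, mul_comm q]
  gcongr
  refine le_trans ?_ h
  gcongr
  exact F.tildeNormOn_mono fun s _ hs => ⟨hJL t ht hI hs, le_rfl⟩

/-- Both the weight and the quasi-concave `k` vary by bounded factors on `(u / 2, u)`. -/
theorem exists_powerWeight_le (ha : PowerBounded a) (ham : AEMeasurable a homPos) :
    ∃ C : ℝ≥0, ∀ k, QuasiConcave k → ∀ u, 0 < u →
      powerWeight θ a k u ≤ C * F.tildeNormOn (Ioo (u / 2) u) (powerWeight θ a k) := by
  obtain ⟨C, hC⟩ := F.exists_le_mul_tildeNormOn_Ioo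
  obtain ⟨D, hD⟩ := ha.exists_le_of_le_two_mul (-θ)
  refine ⟨C * (D * 2), fun k hk u hu => ?_⟩
  have h := hC (u / 2) (half_pos hu) (powerWeight θ a k u)
    (fun s => (D * 2 : ℝ≥0) * powerWeight θ a k s) fun s hs => ?_
  · rw [mul_div_cancel₀ _ (two_ne_zero' ℝ), F.tildeNormOn_const_mul measurableSet_Ioo _
      (aemeasurable_powerWeight θ ham hk.mono), ← mul_assoc] at h
    exact_mod_cast h
  · have hs0 : 0 < s := (half_pos hu).trans hs.1
    calc powerWeight θ a k u ≤ (D * ENNReal.ofReal (s ^ (-θ) * a s)) * (2 * k s) :=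
          mul_le_mul' (hD u s hu hs0 (by linarith [hs.1]) (by linarith [hs.2]))
            (hk.le_two_mul hs0 (by linarith [hs.1]))
      _ = _ := by
          push_cast
          unfold powerWeight
          ring

/-- For `t < u / 2` the inner interval `(t, u)` contains `(u / 2, u)`, so the inner norm dominates
the value at `u`. The outer norm then yields only the norm of `b` over `(0, u / 2)`, and doubling
restores `(0, u)`. -/
theorem exists_powerWeight_mul_le_iterNorm_Ioo (ha : PowerBounded a)
    (ham : AEMeasurable a homPos) (hb : PowerBounded b) (hbm : AEMeasurable b homPos) :
    ∃ C : ℝ≥0, ∀ k, QuasiConcave k → ∀ u, 0 < u →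
      powerWeight θ a k u * E.tildeNormOn (Ioo 0 u) (fun t => ENNReal.ofReal (b t)) ≤
        C * iterNorm E F (Ioo 0 u) (fun t => Ioo t u) θ b a k := by
  obtain ⟨C, hC⟩ := exists_powerWeight_le F (θ := θ) ha ham
  obtain ⟨D, hD⟩ := hb.exists_tildeNormOn_Ioo_two_mul_le hbm E
  refine ⟨C * D, fun k hk u hu => ?_⟩
  have h := hD (u / 2) (half_pos hu)
  rw [mul_div_cancel₀ _ (two_ne_zero' ℝ)] at h
  refine (mul_le_mul' (hC k hk u hu) h).trans ?_
  rw [mul_mul_mul_comm, ENNReal.coe_mul]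
  gcongr
  rw [← E.tildeNormOn_const_mul measurableSet_Ioo _ hbm.ennreal_ofReal]
  refine E.tildeNormOn_mono fun t ht hI => ⟨⟨ht, by linarith [hI.2]⟩, ?_⟩
  rw [mul_comm]
  gcongr
  exact F.tildeNormOn_mono fun s _ hs => ⟨⟨hI.2.trans hs.1, hs.2⟩, le_rfl⟩

/-- Here the inner intervals `(0, t)` with `t > u` all contain `(u / 2, u)`, so no doubling is
needed. The bound is by the full norm, as the cross term requires. -/
theorem exists_powerWeight_mul_le_iterNorm_Ioi (ha : PowerBounded a)
    (ham : AEMeasurable a homPos) (hbm : AEMeasurable b homPos) :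
    ∃ C : ℝ≥0, ∀ k, QuasiConcave k → ∀ u, 0 < u →
      powerWeight θ a k u * E.tildeNormOn (Ioi u) (fun t => ENNReal.ofReal (b t)) ≤
        C * iterNorm E F univ (fun t => Ioo 0 t) θ b a k := by
  obtain ⟨C, hC⟩ := exists_powerWeight_le F (θ := θ) ha ham
  refine ⟨C, fun k hk u hu => ?_⟩
  refine (mul_le_mul_left (hC k hk u hu) _).trans ?_
  rw [mul_assoc]
  gcongr
  rw [← E.tildeNormOn_const_mul measurableSet_Ioi _ hbm.ennreal_ofReal]
  refine E.tildeNormOn_mono fun t ht hI => ⟨mem_univ t, ?_⟩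
  rw [mul_comm]
  gcongr
  exact F.tildeNormOn_mono fun s hs0 hs => ⟨⟨hs0, hs.2.trans hI⟩, le_rfl⟩

/-- Cut both variables at `u`. For `t < u` the inner part on `(t, u)` gives the truncated norm and
the part on `[u, ∞)` gives the value at `u`. For `t ≥ u` the inner tail is of size `t^(-θ) a(t)
k(u)`; a second tail estimate, with weight `a b`, leaves `b u`, which is at most a constant times
the norm of `b` over `(0, u)`. -/
theorem exists_iterNorm_Ioi_le (hθ : 0 < θ) (ha : PowerBounded a)
    (ham : AEMeasurable a homPos) (hb : PowerBounded b) (hbm : AEMeasurable b homPos) (c : ℝ≥0) :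
    ∃ C : ℝ≥0, ∀ k k₀, QuasiConcave k → QuasiConcave k₀ → ∀ u, 0 < u →
      (∀ s, 0 < s → s < u → k₀ s ≤ c * k s) → (∀ s, u ≤ s → k₀ s ≤ c * k u) →
      iterNorm E F univ (fun t => Ioi t) θ b a k₀ ≤
        C * (iterNorm E F (Ioo 0 u) (fun t => Ioo t u) θ b a k +
          powerWeight θ a k u * E.tildeNormOn (Ioo 0 u) fun t => ENNReal.ofReal (b t)) := by
  obtain ⟨C, hC⟩ := ha.exists_tildeNormOn_Ici_le F hθ
  obtain ⟨C', hC'⟩ := (ha.mul hb).exists_tildeNormOn_Ici_le E hθ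
  obtain ⟨D, hD⟩ := hb.exists_le_tildeNormOn_Ioo E
  refine ⟨c + (C * c + C' * (C * c) * D), fun k k₀ hk hk₀ u hu h₁ h₂ => ?_⟩
  have htail : ∀ t, u ≤ t → F.tildeNormOn (Ici t) (powerWeight θ a k₀) ≤
      C * (c * k u * ENNReal.ofReal (t ^ (-θ) * a t)) := fun t ht =>
    hC t (hu.trans_le ht) (c * k u) _ fun s hs => by
      rw [powerWeight, mul_comm]
      gcongr
      exact h₂ s (ht.trans hs)
  set G : ℝ → ℝ≥0∞ := fun t => F.tildeNormOn (Ioo t u) (powerWeight θ a k)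
  have hGm : Measurable G :=
    F.measurable_tildeNormOn_of_antitone (fun _ _ h => Ioo_subset_Ioo_left h) _
  set B := E.tildeNormOn (Ioo 0 u) fun t => ENNReal.ofReal (b t)
  have hw := aemeasurable_powerWeight θ ham hk.mono
  have hw₀ := aemeasurable_powerWeight θ ham hk₀.mono
  have hfun : AEMeasurable (fun t => ENNReal.ofReal (b t) *
      F.tildeNormOn (Ioi t) (powerWeight θ a k₀)) homPos :=
    hbm.ennreal_ofReal.mul (F.measurable_tildeNormOn_of_antitone (J := fun t => Ioi t)
      (fun _ _ h => Ioi_subset_Ioi h) _).aemeasurable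
  have hhead : iterNorm E F (Ioo 0 u) (fun t => Ioi t) θ b a k₀ ≤
      c * iterNorm E F (Ioo 0 u) (fun t => Ioo t u) θ b a k +
        C * c * (powerWeight θ a k u * B) := by
    calc _ ≤ E.tildeNormOn (Ioo 0 u) fun t => c * (ENNReal.ofReal (b t) * G t) +
          C * c * powerWeight θ a k u * ENNReal.ofReal (b t) := by
          refine E.tildeNormOn_mono fun t ht hI => ⟨hI, ?_⟩
          have h3 : F.tildeNormOn (Ioi t) (powerWeight θ a k₀) ≤
              c * G t + C * c * powerWeight θ a k u := by
            refine (F.tildeNormOn_le_add (J := Ioo t u) (L := Ici u) measurableSet_Ioo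
              measurableSet_Ici (fun s _ hs => ?_) hw₀).trans (add_le_add ?_ ?_)
            · rcases lt_or_ge s u with h | h
              · exact Or.inl ⟨hs, h⟩
              · exact Or.inr h
            · rw [← F.tildeNormOn_const_mul measurableSet_Ioo _ hw]
              refine F.tildeNormOn_mono fun s hs0 hs => ⟨hs, ?_⟩
              unfold powerWeight
              rw [mul_left_comm]
              gcongr
              exact h₁ s hs0 hs.2
            · refine (htail u le_rfl).trans_eq ?_
              unfold powerWeight
              ring
          calc _ ≤ ENNReal.ofReal (b t) * (c * G t + C * c * powerWeight θ a k u) := by gcongr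
            _ = _ := by ring
      _ ≤ _ := E.tildeNormOn_add_le measurableSet_Ioo
          ((aemeasurable_mul_of_measurable hbm hGm).const_mul _)
          (hbm.ennreal_ofReal.const_mul _)
      _ = _ := by
          rw [E.tildeNormOn_const_mul measurableSet_Ioo _
            (aemeasurable_mul_of_measurable hbm hGm),
            E.tildeNormOn_const_mul measurableSet_Ioo _ hbm.ennreal_ofReal, mul_assoc (C * c : ℝ≥0∞)]
          rfl
  have htail' : iterNorm E F (Ici u) (fun t => Ioi t) θ b a k₀ ≤
      C' * (C * c) * D * (powerWeight θ a k u * B) := by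
    refine (hC' u hu (C * (c * k u)) _ fun t ht => ?_).trans ?_
    · have hat := ha.pos t (hu.trans_le ht)
      have ht0 := hu.trans_le ht
      calc ENNReal.ofReal (b t) * F.tildeNormOn (Ioi t) (powerWeight θ a k₀) ≤
            ENNReal.ofReal (b t) * (C * (c * k u * ENNReal.ofReal (t ^ (-θ) * a t))) := by
            gcongr
            exact le_trans (F.tildeNormOn_mono (J := Ici t) fun s _ hs => ⟨mem_Ici.2 (le_of_lt hs), le_rfl⟩)
              (htail t ht)
        _ = _ := by
            rw [← mul_assoc (t ^ (-θ)), ENNReal.ofReal_mul (p := t ^ (-θ) * a t) (by positivity)]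
            ring
    · have hau := ha.pos u hu
      rw [← mul_assoc (u ^ (-θ)), ENNReal.ofReal_mul (p := u ^ (-θ) * a u) (by positivity)]
      calc _ ≤ C' * (C * (c * k u) * (ENNReal.ofReal (u ^ (-θ) * a u) * (D * B))) := by
            gcongr
            exact hD u hu
        _ = _ := by
            unfold powerWeight
            ring
  have hsplit := E.tildeNormOn_le_add (I := univ) (J := Ioo 0 u) (L := Ici u) measurableSet_Ioo
    measurableSet_Ici (fun t ht _ => (lt_or_ge t u).imp (fun h => ⟨ht, h⟩) id) hfun
  refine hsplit.trans ((add_le_add hhead htail').trans ?_)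
  push_cast
  generalize iterNorm E F (Ioo 0 u) (fun t => Ioo t u) θ b a k = N
  generalize powerWeight θ a k u * B = R
  calc _ = c * N + (C * c + C' * (C * c) * D) * R := by ring
    _ ≤ (c + (C * c + C' * (C * c) * D)) * N + (c + (C * c + C' * (C * c) * D)) * R :=
        add_le_add (mul_le_mul_left le_self_add N) (mul_le_mul_left le_add_self R)
    _ = _ := by ring

/-- The mirror image of `exists_iterNorm_Ioi_le`: the linear bound on `k₁` below `u` turns the
exponent into `1 - θ > 0`, so integrals towards `0` are controlled at `u`. -/
theorem exists_iterNorm_Ioo_le (hθ : θ < 1) (ha : PowerBounded a)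
    (ham : AEMeasurable a homPos) (hb : PowerBounded b) (hbm : AEMeasurable b homPos) (c : ℝ≥0) :
    ∃ C : ℝ≥0, ∀ k k₁, QuasiConcave k → QuasiConcave k₁ → ∀ u, 0 < u →
      (∀ s, u < s → k₁ s ≤ c * k s) →
      (∀ s, 0 < s → s ≤ u → k₁ s ≤ c * (ENNReal.ofReal (s / u) * k u)) →
      iterNorm E F univ (fun t => Ioo 0 t) θ b a k₁ ≤
        C * (iterNorm E F (Ioi u) (fun t => Ioo u t) θ b a k +
          powerWeight θ a k u * E.tildeNormOn (Ioi u) fun t => ENNReal.ofReal (b t)) := by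
  have hθ' : 0 < 1 - θ := sub_pos.2 hθ
  obtain ⟨C, hC⟩ := ha.exists_tildeNormOn_Ioc_le F hθ'
  obtain ⟨C', hC'⟩ := (ha.mul hb).exists_tildeNormOn_Ioc_le E hθ'
  obtain ⟨D, hD⟩ := hb.exists_le_tildeNormOn_Ioi E
  refine ⟨c + (C * c + C' * (C * c) * D), fun k k₁ hk hk₁ u hu h₁ h₂ => ?_⟩
  have hpow : ∀ t : ℝ, 0 < t → t ^ (1 - θ) = t * t ^ (-θ) := fun t ht => by
    rw [sub_eq_add_neg, Real.rpow_add ht, Real.rpow_one]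
  have htail : ∀ t, 0 < t → t ≤ u → F.tildeNormOn (Ioc 0 t) (powerWeight θ a k₁) ≤
      C * (c * k u * ENNReal.ofReal u⁻¹ * ENNReal.ofReal (t ^ (1 - θ) * a t)) :=
    fun t ht htu => hC t ht (c * k u * ENNReal.ofReal u⁻¹) _ fun s hs hst => by
      have has := ha.pos s hs
      calc powerWeight θ a k₁ s ≤ ENNReal.ofReal (s ^ (-θ) * a s) *
            (c * (ENNReal.ofReal (s / u) * k u)) := by
            unfold powerWeight
            gcongr
            exact h₂ s hs (hst.trans htu)
        _ = _ := by
            rw [hpow s hs, mul_assoc s, ENNReal.ofReal_mul hs.le, div_eq_mul_inv,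
              ENNReal.ofReal_mul hs.le]
            ring
  have hu1 : ENNReal.ofReal u⁻¹ * ENNReal.ofReal u = 1 := by
    rw [← ENNReal.ofReal_mul (by positivity), inv_mul_cancel₀ hu.ne', ENNReal.ofReal_one]
  set G : ℝ → ℝ≥0∞ := fun t => F.tildeNormOn (Ioo u t) (powerWeight θ a k)
  have hGm : Measurable G :=
    F.measurable_tildeNormOn_of_monotone (fun _ _ h => Ioo_subset_Ioo_right h) _
  set B := E.tildeNormOn (Ioi u) fun t => ENNReal.ofReal (b t)
  have hw := aemeasurable_powerWeight θ ham hk.mono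
  have hw₁ := aemeasurable_powerWeight θ ham hk₁.mono
  have hfun : AEMeasurable (fun t => ENNReal.ofReal (b t) *
      F.tildeNormOn (Ioo 0 t) (powerWeight θ a k₁)) homPos :=
    hbm.ennreal_ofReal.mul (F.measurable_tildeNormOn_of_monotone (J := fun t => Ioo 0 t)
      (fun _ _ h => Ioo_subset_Ioo_right h) _).aemeasurable
  have hhead : iterNorm E F (Ioi u) (fun t => Ioo 0 t) θ b a k₁ ≤
      c * iterNorm E F (Ioi u) (fun t => Ioo u t) θ b a k +
        C * c * (powerWeight θ a k u * B) := by
    calc _ ≤ E.tildeNormOn (Ioi u) fun t => c * (ENNReal.ofReal (b t) * G t) +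
          C * c * powerWeight θ a k u * ENNReal.ofReal (b t) := by
          refine E.tildeNormOn_mono fun t ht hI => ⟨hI, ?_⟩
          have h3 : F.tildeNormOn (Ioo 0 t) (powerWeight θ a k₁) ≤
              c * G t + C * c * powerWeight θ a k u := by
            refine (F.tildeNormOn_le_add (J := Ioo u t) (L := Ioc 0 u) measurableSet_Ioo
              measurableSet_Ioc (fun s _ hs => ?_) hw₁).trans (add_le_add ?_ ?_)
            · rcases lt_or_ge u s with h | h
              · exact Or.inl ⟨h, hs.2⟩
              · exact Or.inr ⟨hs.1, h⟩
            · rw [← F.tildeNormOn_const_mul measurableSet_Ioo _ hw]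
              refine F.tildeNormOn_mono fun s hs0 hs => ⟨hs, ?_⟩
              unfold powerWeight
              rw [mul_left_comm]
              gcongr
              exact h₁ s hs.1
            · refine (htail u hu le_rfl).trans_eq ?_
              rw [hpow u hu, mul_assoc u, ENNReal.ofReal_mul hu.le, mul_assoc (c * k u : ℝ≥0∞),
                ← mul_assoc (ENNReal.ofReal u⁻¹), hu1]
              unfold powerWeight
              ring
          calc _ ≤ ENNReal.ofReal (b t) * (c * G t + C * c * powerWeight θ a k u) := by gcongr
            _ = _ := by ring
      _ ≤ _ := E.tildeNormOn_add_le measurableSet_Ioi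
          ((aemeasurable_mul_of_measurable hbm hGm).const_mul _)
          (hbm.ennreal_ofReal.const_mul _)
      _ = _ := by
          rw [E.tildeNormOn_const_mul measurableSet_Ioi _
            (aemeasurable_mul_of_measurable hbm hGm),
            E.tildeNormOn_const_mul measurableSet_Ioi _ hbm.ennreal_ofReal, mul_assoc (C * c : ℝ≥0∞)]
          rfl
  have htail' : iterNorm E F (Ioc 0 u) (fun t => Ioo 0 t) θ b a k₁ ≤
      C' * (C * c) * D * (powerWeight θ a k u * B) := by
    refine (hC' u hu (C * (c * k u * ENNReal.ofReal u⁻¹)) _ fun t ht htu => ?_).trans ?_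
    · have hat := ha.pos t ht
      calc ENNReal.ofReal (b t) * F.tildeNormOn (Ioo 0 t) (powerWeight θ a k₁) ≤
            ENNReal.ofReal (b t) *
            (C * (c * k u * ENNReal.ofReal u⁻¹ * ENNReal.ofReal (t ^ (1 - θ) * a t))) := by
            gcongr
            exact le_trans (F.tildeNormOn_mono (J := Ioc 0 t) fun s _ hs =>
              ⟨⟨hs.1, hs.2.le⟩, le_rfl⟩) (htail t ht htu)
        _ = _ := by
            rw [← mul_assoc (t ^ (1 - θ)),
              ENNReal.ofReal_mul (p := t ^ (1 - θ) * a t) (by positivity)]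
            ring
    · have hau := ha.pos u hu
      rw [← mul_assoc (u ^ (1 - θ)), ENNReal.ofReal_mul (p := u ^ (1 - θ) * a u) (by positivity)]
      calc _ ≤ C' * (C * (c * k u * ENNReal.ofReal u⁻¹) *
            (ENNReal.ofReal (u ^ (1 - θ) * a u) * (D * B))) := by
            gcongr
            exact hD u hu
        _ = C' * (C * c) * D * (ENNReal.ofReal u⁻¹ * ENNReal.ofReal u) *
            (powerWeight θ a k u * B) := by
            rw [hpow u hu, mul_assoc u, ENNReal.ofReal_mul hu.le]
            unfold powerWeight
            ring
        _ = _ := by rw [hu1, mul_one]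
  have hsplit := E.tildeNormOn_le_add (I := univ) (J := Ioi u) (L := Ioc 0 u) measurableSet_Ioi
    measurableSet_Ioc (fun t ht _ => (lt_or_ge u t).imp id (fun h => ⟨ht, h⟩)) hfun
  refine hsplit.trans ((add_le_add hhead htail').trans ?_)
  push_cast
  generalize iterNorm E F (Ioi u) (fun t => Ioo u t) θ b a k = N
  generalize powerWeight θ a k u * B = R
  calc _ = c * N + (C * c + C' * (C * c) * D) * R := by ring
    _ ≤ (c + (C * c + C' * (C * c) * D)) * N + (c + (C * c + C' * (C * c) * D)) * R :=
        add_le_add (mul_le_mul_left le_self_add N) (mul_le_mul_left le_add_self R)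
    _ = _ := by ring

/-- Since `B u ≤ B s` for `s ≥ u`, the pointwise hypothesis holds there with `B u`. Changing the
weight costs `s^(-(θ₁ - θ₀)) a₁(s) / a₀(s)`, whose tail norm is controlled at `u`. The resulting
bound on the inner norm does not depend on `t`, so the outer norm only sees `b`. -/
theorem exists_mul_iterNorm_Ioi_le {θ₀ θ₁ : ℝ} (hθ : θ₀ < θ₁) {a₀ a₁ : ℝ → ℝ}
    (ha₀ : PowerBounded a₀) (ha₁ : PowerBounded a₁) (ha₁m : AEMeasurable a₁ homPos)
    (hbm : AEMeasurable b homPos) :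
    ∃ C : ℝ≥0, ∀ (B : ℝ → ℝ≥0∞) (k : ℝ → ℝ≥0∞) (N : ℝ≥0∞), Monotone B → Monotone k →
      (∀ s, 0 < s → powerWeight θ₀ a₀ k s * B s ≤ N) → ∀ u, 0 < u →
      ENNReal.ofReal (u ^ (-θ₀) * a₀ u) * B u *
          iterNorm E F (Ioi u) (fun t => Ioo u t) θ₁ b a₁ k ≤
        C * (ENNReal.ofReal (u ^ (-θ₁) * a₁ u) *
          E.tildeNormOn (Ioi u) (fun t => ENNReal.ofReal (b t)) * N) := by
  obtain ⟨C, hC⟩ := (ha₁.div ha₀).exists_tildeNormOn_Ici_le F (sub_pos.2 hθ)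
  refine ⟨C, fun B k N hB hk h u hu => ?_⟩
  have hquot : ∀ s, 0 < s → ENNReal.ofReal (s ^ (-θ₁) * a₁ s) =
      ENNReal.ofReal (s ^ (-(θ₁ - θ₀)) * (a₁ s / a₀ s)) *
        ENNReal.ofReal (s ^ (-θ₀) * a₀ s) := fun s hs => by
    have h₀ := ha₀.pos s hs
    have h₁ := ha₁.pos s hs
    rw [← ENNReal.ofReal_mul (by positivity)]
    congr 1
    rw [show -θ₁ = -(θ₁ - θ₀) + -θ₀ by ring, Real.rpow_add hs]
    field_simp
  have h1 : B u * F.tildeNormOn (Ici u) (powerWeight θ₁ a₁ k) ≤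
      C * (N * ENNReal.ofReal (u ^ (-(θ₁ - θ₀)) * (a₁ u / a₀ u))) := by
    rw [← F.tildeNormOn_const_mul measurableSet_Ici _ (aemeasurable_powerWeight θ₁ ha₁m hk)]
    refine hC u hu N _ fun s hs => ?_
    have hs0 := hu.trans_le hs
    rw [powerWeight, hquot s hs0]
    calc _ = ENNReal.ofReal (s ^ (-(θ₁ - θ₀)) * (a₁ s / a₀ s)) *
          (powerWeight θ₀ a₀ k s * B u) := by
          unfold powerWeight
          ring
      _ ≤ ENNReal.ofReal (s ^ (-(θ₁ - θ₀)) * (a₁ s / a₀ s)) * N := by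
          gcongr
          exact (mul_le_mul_right (hB hs) _).trans (h s hs0)
      _ = _ := mul_comm _ _
  -- All inner intervals `(u, t)` are enlarged to `[u, ∞)`.
  refine (mul_iterNorm_le E F (L := Ici u) (q := C * (ENNReal.ofReal (u ^ (-θ₁) * a₁ u) * N))
    measurableSet_Ioi (F.measurable_tildeNormOn_of_monotone fun _ _ h => Ioo_subset_Ioo_right h)
    (fun t _ _ s hs => le_of_lt hs.1) hbm ?_).trans_eq (by ring)
  rw [mul_assoc, hquot u hu]
  calc _ ≤ ENNReal.ofReal (u ^ (-θ₀) * a₀ u) *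
        (C * (N * ENNReal.ofReal (u ^ (-(θ₁ - θ₀)) * (a₁ u / a₀ u)))) := by gcongr
    _ = _ := by ring

theorem exists_mul_iterNorm_Ioo_le {θ₀ θ₁ : ℝ} (hθ : θ₀ < θ₁) {a₀ a₁ : ℝ → ℝ}
    (ha₀ : PowerBounded a₀) (ha₁ : PowerBounded a₁) (ha₀m : AEMeasurable a₀ homPos)
    (hbm : AEMeasurable b homPos) :
    ∃ C : ℝ≥0, ∀ (B : ℝ → ℝ≥0∞) (k : ℝ → ℝ≥0∞) (N : ℝ≥0∞), Antitone B → Monotone k →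
      (∀ s, 0 < s → powerWeight θ₁ a₁ k s * B s ≤ N) → ∀ u, 0 < u →
      ENNReal.ofReal (u ^ (-θ₁) * a₁ u) * B u *
          iterNorm E F (Ioo 0 u) (fun t => Ioo t u) θ₀ b a₀ k ≤
        C * (ENNReal.ofReal (u ^ (-θ₀) * a₀ u) *
          E.tildeNormOn (Ioo 0 u) (fun t => ENNReal.ofReal (b t)) * N) := by
  obtain ⟨C, hC⟩ := (ha₀.div ha₁).exists_tildeNormOn_Ioc_le F (sub_pos.2 hθ)
  refine ⟨C, fun B k N hB hk h u hu => ?_⟩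
  have hquot : ∀ s, 0 < s → ENNReal.ofReal (s ^ (-θ₀) * a₀ s) =
      ENNReal.ofReal (s ^ (θ₁ - θ₀) * (a₀ s / a₁ s)) *
        ENNReal.ofReal (s ^ (-θ₁) * a₁ s) := fun s hs => by
    have h₀ := ha₀.pos s hs
    have h₁ := ha₁.pos s hs
    rw [← ENNReal.ofReal_mul (by positivity)]
    congr 1
    rw [show -θ₀ = (θ₁ - θ₀) + -θ₁ by ring, Real.rpow_add hs]
    field_simp
  have h1 : B u * F.tildeNormOn (Ioc 0 u) (powerWeight θ₀ a₀ k) ≤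
      C * (N * ENNReal.ofReal (u ^ (θ₁ - θ₀) * (a₀ u / a₁ u))) := by
    rw [← F.tildeNormOn_const_mul measurableSet_Ioc _ (aemeasurable_powerWeight θ₀ ha₀m hk)]
    refine hC u hu N _ fun s hs0 hs => ?_
    rw [powerWeight, hquot s hs0]
    calc _ = ENNReal.ofReal (s ^ (θ₁ - θ₀) * (a₀ s / a₁ s)) *
          (powerWeight θ₁ a₁ k s * B u) := by
          unfold powerWeight
          ring
      _ ≤ ENNReal.ofReal (s ^ (θ₁ - θ₀) * (a₀ s / a₁ s)) * N := by
          gcongr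
          exact (mul_le_mul_right (hB hs) _).trans (h s hs0)
      _ = _ := mul_comm _ _
  refine (mul_iterNorm_le E F (L := Ioc 0 u) (q := C * (ENNReal.ofReal (u ^ (-θ₀) * a₀ u) * N))
    measurableSet_Ioo (F.measurable_tildeNormOn_of_antitone fun _ _ h => Ioo_subset_Ioo_left h)
    (fun t ht _ s hs => ⟨ht.trans hs.1, hs.2.le⟩) hbm ?_).trans_eq (by ring)
  rw [mul_assoc, hquot u hu]
  calc _ ≤ ENNReal.ofReal (u ^ (-θ₁) * a₁ u) *
        (C * (N * ENNReal.ofReal (u ^ (θ₁ - θ₀) * (a₀ u / a₁ u)))) := by gcongr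
    _ = _ := by ring

end RISpace

/-- Isolates one summand on the right, so that an infimum can be treated there by `le_peetreK`. -/
theorem ENNReal.le_mul_add_of_forall {c κ x y : ℝ≥0∞} (hκ : κ ≠ 0) (hκ' : κ ≠ ∞)
    (h : c / κ - y ≤ x) : c ≤ κ * (x + y) := by
  rwa [tsub_le_iff_right, ENNReal.div_le_iff_le_mul (Or.inl hκ) (Or.inl hκ'), mul_comm] at h

/-! ### The `K`-functional of a compatible couple. -/

section Peetre

variable {V : Type*} [AddCommGroup V] {N₀ N₁ : V → ℝ≥0∞}

theorem peetreK_le {t : ℝ≥0∞} {f₀ f₁ : V} (h₀ : N₀ f₀ < ∞) (h₁ : N₁ f₁ < ∞) :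
    peetreK N₀ N₁ t (f₀ + f₁) ≤ N₀ f₀ + t * N₁ f₁ :=
  iInf_le_of_le f₀ (iInf_le_of_le f₁ (iInf_le_of_le ⟨h₀, h₁, rfl⟩ le_rfl))

theorem le_peetreK {t c : ℝ≥0∞} {f : V}
    (h : ∀ f₀ f₁, N₀ f₀ < ∞ → N₁ f₁ < ∞ → f = f₀ + f₁ → c ≤ N₀ f₀ + t * N₁ f₁) :
    c ≤ peetreK N₀ N₁ t f :=
  le_iInf fun f₀ => le_iInf fun f₁ => le_iInf fun hf => h f₀ f₁ hf.1 hf.2.1 hf.2.2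

theorem quasiConcave_peetreK (f : V) :
    QuasiConcave fun s => peetreK N₀ N₁ (ENNReal.ofReal s) f := by
  constructor
  · intro s t hst
    refine le_peetreK fun f₀ f₁ h₀ h₁ hf => hf ▸ (peetreK_le h₀ h₁).trans ?_
    gcongr
  · intro s t hs hst
    have hs0 : ENNReal.ofReal s ≠ 0 := by simpa using hs
    have ht0 : ENNReal.ofReal t ≠ 0 := by simpa using hs.trans_le hst
    rw [mul_comm (ENNReal.ofReal t),
      ← ENNReal.div_le_iff_le_mul (Or.inl ht0) (Or.inl ENNReal.ofReal_ne_top)]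
    refine le_peetreK fun f₀ f₁ h₀ h₁ hf => ?_
    rw [ENNReal.div_le_iff_le_mul (Or.inl ht0) (Or.inl ENNReal.ofReal_ne_top), hf]
    calc _ ≤ ENNReal.ofReal s * (N₀ f₀ + ENNReal.ofReal t * N₁ f₁) := by
          gcongr
          exact peetreK_le h₀ h₁
      _ = ENNReal.ofReal s * N₀ f₀ + ENNReal.ofReal s * N₁ f₁ * ENNReal.ofReal t := by ring
      _ ≤ ENNReal.ofReal t * N₀ f₀ + ENNReal.ofReal s * N₁ f₁ * ENNReal.ofReal t := by
          gcongr
      _ = _ := by ring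

theorem normR_of_mem {θ : ℝ} {b a : ℝ → ℝ} {E F : RISpace} {f : V} (hf : f ∈ sumSpace N₀ N₁) :
    normR N₀ N₁ θ b E a F f = E.iterNorm F univ (fun t => Ioi t) θ b a
      fun s => peetreK N₀ N₁ (ENNReal.ofReal s) f := by
  rw [normR, if_pos hf, RISpace.iterNorm, RISpace.tildeNormOn, indicator_univ]
  rfl

theorem normL_of_mem {θ : ℝ} {b a : ℝ → ℝ} {E F : RISpace} {f : V} (hf : f ∈ sumSpace N₀ N₁) :
    normL N₀ N₁ θ b E a F f = E.iterNorm F univ (fun t => Ioo 0 t) θ b a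
      fun s => peetreK N₀ N₁ (ENNReal.ofReal s) f := by
  rw [normL, if_pos hf, RISpace.iterNorm, RISpace.tildeNormOn, indicator_univ]
  rfl

theorem mem_sumSpace_of_normR_lt_top {θ : ℝ} {b a : ℝ → ℝ} {E F : RISpace} {f : V}
    (h : normR N₀ N₁ θ b E a F f < ∞) : f ∈ sumSpace N₀ N₁ := by
  by_contra hf
  simp [normR, hf] at h

theorem mem_sumSpace_of_normL_lt_top {θ : ℝ} {b a : ℝ → ℝ} {E F : RISpace} {f : V}
    (h : normL N₀ N₁ θ b E a F f < ∞) : f ∈ sumSpace N₀ N₁ := by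
  by_contra hf
  simp [normL, hf] at h

end Peetre

namespace QuasiBanachIn

variable {𝕜 V : Type*} [RCLike 𝕜] [AddCommGroup V] [Module 𝕜 V] [TopologicalSpace V]
  (X X₀ X₁ : QuasiBanachIn 𝕜 V)

theorem qnorm_zero : X.qnorm 0 = 0 := (X.qnorm_eq_zero_iff 0).2 rfl

theorem qnorm_neg (f : V) : X.qnorm (-f) = X.qnorm f := by
  simpa using X.qnorm_smul (-1) f

theorem exists_qnorm_add_le :
    ∃ κ : ℝ≥0, 1 ≤ κ ∧ (∀ f g, X₀.qnorm (f + g) ≤ κ * (X₀.qnorm f + X₀.qnorm g)) ∧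
      ∀ f g, X₁.qnorm (f + g) ≤ κ * (X₁.qnorm f + X₁.qnorm g) := by
  obtain ⟨κ₀, h₀⟩ := X₀.qnorm_add_le
  obtain ⟨κ₁, h₁⟩ := X₁.qnorm_add_le
  refine ⟨max 1 (max κ₀ κ₁), le_max_left _ _, fun f g => (h₀ f g).trans ?_,
    fun f g => (h₁ f g).trans ?_⟩ <;> gcongr <;> simp

theorem add_mem_sumSpace {f g : V} (hf : f ∈ sumSpace X₀.qnorm X₁.qnorm)
    (hg : g ∈ sumSpace X₀.qnorm X₁.qnorm) : f + g ∈ sumSpace X₀.qnorm X₁.qnorm := by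
  obtain ⟨f₀, f₁, hf₀, hf₁, rfl⟩ := hf
  obtain ⟨g₀, g₁, hg₀, hg₁, rfl⟩ := hg
  obtain ⟨κ, -, h₀, h₁⟩ := exists_qnorm_add_le X₀ X₁
  exact ⟨f₀ + g₀, f₁ + g₁, (h₀ _ _).trans_lt (by finiteness), (h₁ _ _).trans_lt (by finiteness),
    add_add_add_comm _ _ _ _⟩

theorem exists_peetreK_add_le : ∃ κ : ℝ≥0, 1 ≤ κ ∧ ∀ t f g,
    peetreK X₀.qnorm X₁.qnorm t (f + g) ≤
      κ * (peetreK X₀.qnorm X₁.qnorm t f + peetreK X₀.qnorm X₁.qnorm t g) := by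
  obtain ⟨κ, hκ, h₀, h₁⟩ := exists_qnorm_add_le X₀ X₁
  have hκ0 : (κ : ℝ≥0∞) ≠ 0 := by simpa using (one_pos.trans_le hκ).ne'
  refine ⟨κ, hκ, fun t f g => ENNReal.le_mul_add_of_forall hκ0 ENNReal.coe_ne_top ?_⟩
  refine le_peetreK fun f₀ f₁ hf₀ hf₁ hf => ?_
  -- Exchanges the roles of the two terms, leaving the infimum for `g` alone on the right.
  rw [tsub_le_iff_left, ← tsub_le_iff_right]
  refine le_peetreK fun g₀ g₁ hg₀ hg₁ hg => ?_
  rw [tsub_le_iff_right, ENNReal.div_le_iff_le_mul (Or.inl hκ0) (Or.inl ENNReal.coe_ne_top), hf, hg,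
    add_add_add_comm]
  refine (peetreK_le ((h₀ _ _).trans_lt (by finiteness))
    ((h₁ _ _).trans_lt (by finiteness))).trans ?_
  calc _ ≤ κ * (X₀.qnorm f₀ + X₀.qnorm g₀) + t * (κ * (X₁.qnorm f₁ + X₁.qnorm g₁)) := by
        gcongr
        · exact h₀ _ _
        · exact h₁ _ _
    _ = _ := by ring

theorem peetreK_le_left {t : ℝ≥0∞} {f : V} (hf : X₀.qnorm f < ∞) :
    peetreK X₀.qnorm X₁.qnorm t f ≤ X₀.qnorm f := by
  have h := peetreK_le (N₁ := X₁.qnorm) (t := t) (f₁ := 0) hf (by simp [qnorm_zero])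
  simpa [qnorm_zero] using h

theorem peetreK_le_right {t : ℝ≥0∞} {f : V} (hf : X₁.qnorm f < ∞) :
    peetreK X₀.qnorm X₁.qnorm t f ≤ t * X₁.qnorm f := by
  have h := peetreK_le (N₀ := X₀.qnorm) (t := t) (f₀ := 0) (by simp [qnorm_zero]) hf
  simpa [qnorm_zero] using h

variable {X₀ X₁}

/-- A vanishing infimum provides summands `f₀`, `f₁` as small as desired, hence near `0` in `V` by
the continuous embeddings; their sum would avoid no neighbourhood of `0`, contradicting
Hausdorffness unless `f = 0`. -/
theorem eq_zero_of_peetreK_eq_zero [IsTopologicalAddGroup V] [T2Space V] {t : ℝ≥0∞} (ht : t ≠ 0)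
    {f : V} (h : peetreK X₀.qnorm X₁.qnorm t f = 0) : f = 0 := by
  by_contra hf
  have hU : {f}ᶜ ∈ 𝓝 (0 : V) := isOpen_compl_singleton.mem_nhds (Ne.symm hf)
  obtain ⟨W, hW, hWU⟩ := exists_nhds_zero_half hU
  obtain ⟨ε₀, hε₀, h₀⟩ := X₀.embedding W hW
  obtain ⟨ε₁, hε₁, h₁⟩ := X₁.embedding W hW
  have hlt : peetreK X₀.qnorm X₁.qnorm t f < min ε₀ (t * ε₁) := by
    rw [h]
    exact lt_min hε₀ (ENNReal.mul_pos ht hε₁.ne')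
  simp only [peetreK, iInf_lt_iff] at hlt
  obtain ⟨f₀, f₁, ⟨-, -, hff⟩, hlt⟩ := hlt
  rw [lt_min_iff] at hlt
  have hf₀ := h₀ f₀ (le_self_add.trans_lt hlt.1)
  have hf₁ := h₁ f₁ (lt_of_mul_lt_mul_left' (le_add_self.trans_lt hlt.2))
  exact hWU f₀ hf₀ f₁ hf₁ hff.symm

/-- The factor `2` leaves room above the infimum only when that is finite and nonzero; if it is `0`,
then `f = 0` and the trivial splitting works. -/
theorem exists_add_le_two_mul_peetreK [IsTopologicalAddGroup V] [T2Space V] {t : ℝ≥0∞}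
    (ht : t ≠ 0) (ht' : t ≠ ∞) {f : V} (hf : f ∈ sumSpace X₀.qnorm X₁.qnorm) :
    ∃ f₀ f₁, X₀.qnorm f₀ < ∞ ∧ X₁.qnorm f₁ < ∞ ∧ f = f₀ + f₁ ∧
      X₀.qnorm f₀ + t * X₁.qnorm f₁ ≤ 2 * peetreK X₀.qnorm X₁.qnorm t f := by
  rcases eq_or_ne (peetreK X₀.qnorm X₁.qnorm t f) 0 with h | h
  · refine ⟨0, 0, ?_⟩
    simp [qnorm_zero, eq_zero_of_peetreK_eq_zero ht h]
  · have hfin : peetreK X₀.qnorm X₁.qnorm t f ≠ ∞ := by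
      obtain ⟨f₀, f₁, hf₀, hf₁, rfl⟩ := hf
      exact ((peetreK_le hf₀ hf₁).trans_lt (by finiteness)).ne
    have hlt : peetreK X₀.qnorm X₁.qnorm t f < 2 * peetreK X₀.qnorm X₁.qnorm t f := by
      rw [two_mul]
      exact ENNReal.lt_add_right hfin h
    conv_lhs at hlt => rw [peetreK]
    simp only [iInf_lt_iff] at hlt
    obtain ⟨f₀, f₁, ⟨hf₀, hf₁, hff⟩, hlt⟩ := hlt
    exact ⟨f₀, f₁, hf₀, hf₁, hff, hlt.le⟩

end QuasiBanachIn

/-- A near-optimal decomposition `f = f₀ + f₁` for `K(u, f; X₀, X₁)`, with the bounds for the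
`K`-functionals of the two summands. -/
theorem exists_decomposition {𝕜 V : Type*} [RCLike 𝕜] [AddCommGroup V] [Module 𝕜 V]
    [TopologicalSpace V] [IsTopologicalAddGroup V] [T2Space V] (X₀ X₁ : QuasiBanachIn 𝕜 V) :
    ∃ c : ℝ≥0, ∀ f ∈ sumSpace X₀.qnorm X₁.qnorm, ∀ u : ℝ, 0 < u →
      ∃ f₀ ∈ sumSpace X₀.qnorm X₁.qnorm, ∃ f₁ ∈ sumSpace X₀.qnorm X₁.qnorm, f = f₀ + f₁ ∧
        (∀ s, 0 < s → s < u → peetreK X₀.qnorm X₁.qnorm (ENNReal.ofReal s) f₀ ≤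
          c * peetreK X₀.qnorm X₁.qnorm (ENNReal.ofReal s) f) ∧
        (∀ s, u ≤ s → peetreK X₀.qnorm X₁.qnorm (ENNReal.ofReal s) f₀ ≤
          c * peetreK X₀.qnorm X₁.qnorm (ENNReal.ofReal u) f) ∧
        (∀ s, u < s → peetreK X₀.qnorm X₁.qnorm (ENNReal.ofReal s) f₁ ≤
          c * peetreK X₀.qnorm X₁.qnorm (ENNReal.ofReal s) f) ∧
        ∀ s, 0 < s → s ≤ u → peetreK X₀.qnorm X₁.qnorm (ENNReal.ofReal s) f₁ ≤
          c * (ENNReal.ofReal (s / u) * peetreK X₀.qnorm X₁.qnorm (ENNReal.ofReal u) f) := by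
  obtain ⟨κ, hκ, hadd⟩ := QuasiBanachIn.exists_peetreK_add_le X₀ X₁
  -- The `3` is `1 + 2`: one summand is controlled by `f` minus the other, and the other costs twice
  -- the `K`-functional.
  refine ⟨3 * κ, fun f hf u hu => ?_⟩
  have hu0 : ENNReal.ofReal u ≠ 0 := by simpa using hu
  obtain ⟨f₀, f₁, hf₀, hf₁, hff, hle⟩ :=
    QuasiBanachIn.exists_add_le_two_mul_peetreK hu0 ENNReal.ofReal_ne_top hf
  have hk := quasiConcave_peetreK (N₀ := X₀.qnorm) (N₁ := X₁.qnorm) f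
  set k := fun s => peetreK X₀.qnorm X₁.qnorm (ENNReal.ofReal s) f with hkdef
  have hle₀ : X₀.qnorm f₀ ≤ 2 * k u := le_self_add.trans hle
  have hle₁ : ENNReal.ofReal u * X₁.qnorm f₁ ≤ 2 * k u := le_add_self.trans hle
  have h2 : (2 : ℝ≥0∞) ≤ (3 * κ : ℝ≥0) := by
    have : (2 : ℝ≥0) ≤ 3 * κ := by
      calc (2 : ℝ≥0) ≤ 3 * 1 := by norm_num
        _ ≤ 3 * κ := by gcongr
    exact_mod_cast this
  have h3 : ∀ x : ℝ≥0∞, κ * (x + 2 * x) = (3 * κ : ℝ≥0) * x := fun x => by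
    push_cast
    ring
  refine ⟨f₀, ⟨f₀, 0, hf₀, by simp [QuasiBanachIn.qnorm_zero], by simp⟩,
    f₁, ⟨0, f₁, by simp [QuasiBanachIn.qnorm_zero], hf₁, by simp⟩, hff, fun s hs hsu => ?_,
    fun s hs => ?_, fun s hs => ?_, fun s hs hsu => ?_⟩
  -- Below `u`, `f₀` is estimated as `f - f₁`; since `k(s) / s` is nonincreasing, the bound on `f₁`
  -- at `u` passes to `s`.
  · have h4 : ENNReal.ofReal s * X₁.qnorm f₁ ≤ 2 * k s := by
      rw [← ENNReal.mul_le_mul_iff_right hu0 ENNReal.ofReal_ne_top]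
      calc _ = ENNReal.ofReal s * (ENNReal.ofReal u * X₁.qnorm f₁) := by ring
        _ ≤ ENNReal.ofReal s * (2 * k u) := by gcongr
        _ = 2 * (ENNReal.ofReal s * k u) := by ring
        _ ≤ 2 * (ENNReal.ofReal u * k s) := by
            gcongr 2 * ?_
            exact hk.ofReal_mul_le s u hs hsu.le
        _ = _ := by ring
    rw [← h3, show f₀ = f + -f₁ by rw [hff, add_neg_cancel_right]]
    refine (hadd _ f (-f₁)).trans ?_
    gcongr
    refine (QuasiBanachIn.peetreK_le_right X₀ X₁ (by rwa [QuasiBanachIn.qnorm_neg])).trans ?_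
    rwa [QuasiBanachIn.qnorm_neg]
  · refine (QuasiBanachIn.peetreK_le_left X₀ X₁ hf₀).trans (hle₀.trans ?_)
    gcongr
  · rw [← h3, show f₁ = f + -f₀ by rw [hff, add_comm f₀, add_neg_cancel_right]]
    refine (hadd _ f (-f₀)).trans ?_
    gcongr
    refine (QuasiBanachIn.peetreK_le_left X₀ X₁ (by rwa [QuasiBanachIn.qnorm_neg])).trans ?_
    rw [QuasiBanachIn.qnorm_neg]
    refine hle₀.trans ?_
    gcongr 2 * ?_
    exact hk.mono hs.le
  · refine (QuasiBanachIn.peetreK_le_right X₀ X₁ hf₁).trans ?_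
    have hsu' : ENNReal.ofReal s = ENNReal.ofReal (s / u) * ENNReal.ofReal u := by
      rw [← ENNReal.ofReal_mul (by positivity), div_mul_cancel₀ _ hu.ne']
    calc _ = ENNReal.ofReal (s / u) * (ENNReal.ofReal u * X₁.qnorm f₁) := by rw [hsu']; ring
      _ ≤ ENNReal.ofReal (s / u) * (2 * k u) := by gcongr
      _ = 2 * (ENNReal.ofReal (s / u) * k u) := by ring
      _ ≤ _ := by gcongr

/-! ### The balancing property of `ρ` and the two-sided estimate. -/

theorem rhoRL_mul {θ₀ θ₁ : ℝ} {b₀ b₁ a₀ a₁ : ℝ → ℝ} {E₀ E₁ : RISpace} {u : ℝ} (hu : 0 < u)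
    (ha₁ : 0 < a₁ u)
    (hB0 : E₁.tildeNormOn (Ioi u) (fun t => ENNReal.ofReal (b₁ t)) ≠ 0)
    (hB : E₁.tildeNormOn (Ioi u) (fun t => ENNReal.ofReal (b₁ t)) ≠ ∞) :
    rhoRL θ₀ θ₁ b₀ b₁ a₀ a₁ E₀ E₁ u * (ENNReal.ofReal (u ^ (-θ₁) * a₁ u) *
        E₁.tildeNormOn (Ioi u) fun t => ENNReal.ofReal (b₁ t)) =
      ENNReal.ofReal (u ^ (-θ₀) * a₀ u) *
        E₀.tildeNormOn (Ioo 0 u) fun t => ENNReal.ofReal (b₀ t) := by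
  have hpow : u ^ (-θ₀) = u ^ (θ₁ - θ₀) * u ^ (-θ₁) := by
    rw [← Real.rpow_add hu]
    congr 1
    ring
  have ha : ENNReal.ofReal (a₁ u) ≠ 0 := by simpa using ha₁
  rw [rhoRL, hpow, ENNReal.ofReal_mul (p := u ^ (-θ₁)) (by positivity),
    ENNReal.ofReal_mul (p := u ^ (θ₁ - θ₀) * u ^ (-θ₁)) (by positivity),
    ENNReal.ofReal_mul (p := u ^ (θ₁ - θ₀)) (by positivity)]
  set B₀ := E₀.tildeNormOn (Ioo 0 u) fun t => ENNReal.ofReal (b₀ t)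
  set B₁ := E₁.tildeNormOn (Ioi u) fun t => ENNReal.ofReal (b₁ t)
  calc _ = ENNReal.ofReal (u ^ (θ₁ - θ₀)) * ENNReal.ofReal (u ^ (-θ₁)) *
        (ENNReal.ofReal (a₀ u) * B₀ / (ENNReal.ofReal (a₁ u) * B₁) *
          (ENNReal.ofReal (a₁ u) * B₁)) := by ring
    _ = _ := by
      rw [ENNReal.div_mul_cancel (mul_ne_zero ha hB0) (by finiteness)]
      ring

theorem theorem3p3 {𝕜 V : Type*} [RCLike 𝕜] [AddCommGroup V] [Module 𝕜 V]
    [TopologicalSpace V] [IsTopologicalAddGroup V] [ContinuousSMul 𝕜 V] [T2Space V]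
    (X₀ X₁ : QuasiBanachIn 𝕜 V)
    (θ₀ θ₁ : ℝ) (hθ₀ : 0 < θ₀) (hθ : θ₀ < θ₁) (hθ₁ : θ₁ < 1)
    (E₀ E₁ F₀ F₁ : RISpace) (a₀ a₁ b₀ b₁ : ℝ → ℝ)
    (ha₀ : SlowlyVarying a₀) (ha₁ : SlowlyVarying a₁)
    (hb₀ : SlowlyVarying b₀) (hb₁ : SlowlyVarying b₁)
    (hE₀ : E₀.tildeNormOn (Ioo 0 1) (fun t => ENNReal.ofReal (b₀ t)) < ∞)
    (hE₁ : E₁.tildeNormOn (Ioi 1) (fun t => ENNReal.ofReal (b₁ t)) < ∞) :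
    let N₀ := normR X₀.qnorm X₁.qnorm θ₀ b₀ E₀ a₀ F₀
    let N₁ := normL X₀.qnorm X₁.qnorm θ₁ b₁ E₁ a₁ F₁
    let ρ := rhoRL θ₀ θ₁ b₀ b₁ a₀ a₁ E₀ E₁
    let H : V → ℝ → ℝ≥0∞ := fun f u =>
      E₀.tildeNormOn (Ioo 0 u) (fun t => ENNReal.ofReal (b₀ t) *
        F₀.tildeNormOn (Ioo t u) (weightedK X₀.qnorm X₁.qnorm θ₀ a₀ f)) +
      ρ u * E₁.tildeNormOn (Ioi u) (fun t => ENNReal.ofReal (b₁ t) *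
        F₁.tildeNormOn (Ioo u t) (weightedK X₀.qnorm X₁.qnorm θ₁ a₁ f))
    ∃ C : ℝ≥0, 0 < C ∧ ∀ f ∈ sumSpace N₀ N₁, ∀ u : ℝ, 0 < u →
      peetreK N₀ N₁ (ρ u) f ≤ C * H f u ∧ H f u ≤ C * peetreK N₀ N₁ (ρ u) f := by
  intro N₀ N₁ ρ H
  have hma₀ := ha₀.aemeasurable.mono_ac homPos_absolutelyContinuous
  have hma₁ := ha₁.aemeasurable.mono_ac homPos_absolutelyContinuous
  have hmb₀ := hb₀.aemeasurable.mono_ac homPos_absolutelyContinuous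
  have hmb₁ := hb₁.aemeasurable.mono_ac homPos_absolutelyContinuous
  replace ha₀ := ha₀.powerBounded
  replace ha₁ := ha₁.powerBounded
  replace hb₀ := hb₀.powerBounded
  replace hb₁ := hb₁.powerBounded
  set B₀ : ℝ → ℝ≥0∞ := fun u => E₀.tildeNormOn (Ioo 0 u) fun t => ENNReal.ofReal (b₀ t)
  set B₁ : ℝ → ℝ≥0∞ := fun u => E₁.tildeNormOn (Ioi u) fun t => ENNReal.ofReal (b₁ t)
  have hB₀mono : Monotone B₀ := fun s t hst =>
    E₀.tildeNormOn_mono fun x _ hx => ⟨⟨hx.1, hx.2.trans_le hst⟩, le_rfl⟩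
  have hB₁anti : Antitone B₁ := fun s t hst =>
    E₁.tildeNormOn_mono fun x _ hx => ⟨hst.trans_lt hx, le_rfl⟩
  have hB₀fin : ∀ u, B₀ u ≠ ∞ := hb₀.tildeNormOn_Ioo_ne_top hmb₀ E₀ hE₀
  have hB₁fin : ∀ u, 0 < u → B₁ u ≠ ∞ := fun u hu => hb₁.tildeNormOn_Ioi_ne_top hmb₁ E₁ hE₁ hu
  have hB₀pos : ∀ u, 0 < u → B₀ u ≠ 0 := fun u hu h0 => by
    obtain ⟨C, hC⟩ := hb₀.exists_le_tildeNormOn_Ioo E₀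
    have h : ENNReal.ofReal (b₀ u) ≤ C * B₀ u := hC u hu
    simp [h0, (hb₀.pos u hu).not_ge] at h
  have hB₁pos : ∀ u, 0 < u → B₁ u ≠ 0 := fun u hu h0 => by
    obtain ⟨C, hC⟩ := hb₁.exists_le_tildeNormOn_Ioi E₁
    have h : ENNReal.ofReal (b₁ u) ≤ C * B₁ u := hC u hu
    simp [h0, (hb₁.pos u hu).not_ge] at h
  have hw₀ : ∀ u, 0 < u → ENNReal.ofReal (u ^ (-θ₀) * a₀ u) ≠ 0 := fun u hu => by
    have := ha₀.pos u hu
    simp only [ne_eq, ENNReal.ofReal_eq_zero, not_le]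
    positivity
  have hw₁ : ∀ u, 0 < u → ENNReal.ofReal (u ^ (-θ₁) * a₁ u) ≠ 0 := fun u hu => by
    have := ha₁.pos u hu
    simp only [ne_eq, ENNReal.ofReal_eq_zero, not_le]
    positivity
  have hρ : ∀ u, 0 < u → ρ u * (ENNReal.ofReal (u ^ (-θ₁) * a₁ u) * B₁ u) =
      ENNReal.ofReal (u ^ (-θ₀) * a₀ u) * B₀ u := fun u hu =>
    rhoRL_mul hu (ha₁.pos u hu) (hB₁pos u hu) (hB₁fin u hu)
  -- Needed to deduce that the `L`-norm of `f₁` is finite once `ρ u` times it is.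
  have hρ0 : ∀ u, 0 < u → ρ u ≠ 0 := fun u hu h0 => by
    have h := hρ u hu
    rw [h0, zero_mul] at h
    exact mul_ne_zero (hw₀ u hu) (hB₀pos u hu) h.symm
  set K : V → ℝ → ℝ≥0∞ := fun f s => peetreK X₀.qnorm X₁.qnorm (ENNReal.ofReal s) f
  have hK : ∀ f, QuasiConcave (K f) := fun f => quasiConcave_peetreK f
  set h₀ : V → ℝ → ℝ≥0∞ := fun f u =>
    E₀.iterNorm F₀ (Ioo 0 u) (fun t => Ioo t u) θ₀ b₀ a₀ (K f)
  set h₁ : V → ℝ → ℝ≥0∞ := fun f u =>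
    E₁.iterNorm F₁ (Ioi u) (fun t => Ioo u t) θ₁ b₁ a₁ (K f)
  have hH : ∀ f u, H f u = h₀ f u + ρ u * h₁ f u := fun f u => rfl
  obtain ⟨A₀, hA₀⟩ := E₀.exists_powerWeight_mul_le_iterNorm_Ioo F₀ (θ := θ₀) ha₀ hma₀ hb₀ hmb₀
  obtain ⟨A₁, hA₁⟩ := E₁.exists_powerWeight_mul_le_iterNorm_Ioi F₁ (θ := θ₁) ha₁ hma₁ hmb₁
  obtain ⟨c, hdec⟩ := exists_decomposition X₀ X₁
  obtain ⟨C₀, hC₀⟩ := E₀.exists_iterNorm_Ioi_le F₀ hθ₀ ha₀ hma₀ hb₀ hmb₀ c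
  obtain ⟨C₁, hC₁⟩ := E₁.exists_iterNorm_Ioo_le F₁ hθ₁ ha₁ hma₁ hb₁ hmb₁ c
  obtain ⟨D₁, hD₁⟩ := E₁.exists_mul_iterNorm_Ioi_le F₁ hθ ha₀ ha₁ hma₁ hmb₁
  obtain ⟨D₀, hD₀⟩ := E₀.exists_mul_iterNorm_Ioo_le F₀ hθ ha₀ ha₁ hma₀ hmb₀
  obtain ⟨κ, -, hadd⟩ := QuasiBanachIn.exists_peetreK_add_le X₀ X₁
  have hN₀ : ∀ f ∈ sumSpace X₀.qnorm X₁.qnorm, N₀ f =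
      E₀.iterNorm F₀ univ (fun t => Ioi t) θ₀ b₀ a₀ (K f) := fun f hf => normR_of_mem hf
  have hN₁ : ∀ f ∈ sumSpace X₀.qnorm X₁.qnorm, N₁ f =
      E₁.iterNorm F₁ univ (fun t => Ioo 0 t) θ₁ b₁ a₁ (K f) := fun f hf => normL_of_mem hf
  have hsum₀ : ∀ g, N₀ g < ∞ → g ∈ sumSpace X₀.qnorm X₁.qnorm := fun g hg =>
    mem_sumSpace_of_normR_lt_top hg
  have hsum₁ : ∀ g, N₁ g < ∞ → g ∈ sumSpace X₀.qnorm X₁.qnorm := fun g hg =>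
    mem_sumSpace_of_normL_lt_top hg
  -- Finiteness of `H f u` makes the splitting admissible: the infimum only ranges over summands of
  -- finite norm.
  have upper : ∀ f ∈ sumSpace N₀ N₁, ∀ u, 0 < u → H f u < ∞ →
      peetreK N₀ N₁ (ρ u) f ≤ ((C₀ + C₁) * (1 + A₀) : ℝ≥0) * H f u := by
    rintro f ⟨g₀, g₁, hg₀, hg₁, hg⟩ u hu hfin
    have hf : f ∈ sumSpace X₀.qnorm X₁.qnorm :=
      hg ▸ QuasiBanachIn.add_mem_sumSpace X₀ X₁ (hsum₀ g₀ hg₀) (hsum₁ g₁ hg₁)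
    obtain ⟨f₀, hf₀, f₁, hf₁, hff, h01, h02, h11, h12⟩ := hdec f hf u hu
    have e₀ : N₀ f₀ ≤ C₀ * (h₀ f u + powerWeight θ₀ a₀ (K f) u * B₀ u) :=
      (hN₀ f₀ hf₀).trans_le (hC₀ (K f) (K f₀) (hK f) (hK f₀) u hu h01 h02)
    have e₁ : N₁ f₁ ≤ C₁ * (h₁ f u + powerWeight θ₁ a₁ (K f) u * B₁ u) :=
      (hN₁ f₁ hf₁).trans_le (hC₁ (K f) (K f₁) (hK f) (hK f₁) u hu h11 h12)
    have e₂ : powerWeight θ₀ a₀ (K f) u * B₀ u ≤ A₀ * h₀ f u := hA₀ (K f) (hK f) u hu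
    have e₃ : ρ u * (powerWeight θ₁ a₁ (K f) u * B₁ u) = powerWeight θ₀ a₀ (K f) u * B₀ u := by
      calc _ = ρ u * (ENNReal.ofReal (u ^ (-θ₁) * a₁ u) * B₁ u) * K f u := by
            unfold powerWeight
            ring
        _ = _ := by
            rw [hρ u hu]
            unfold powerWeight
            ring
    have e₄ : N₀ f₀ + ρ u * N₁ f₁ ≤ ((C₀ + C₁) * (1 + A₀) : ℝ≥0) * H f u := by
      rw [hH]
      calc _ ≤ C₀ * (h₀ f u + A₀ * h₀ f u) +
            ρ u * (C₁ * (h₁ f u + powerWeight θ₁ a₁ (K f) u * B₁ u)) := by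
            gcongr
            exact e₀.trans (by gcongr)
        _ = C₀ * (h₀ f u + A₀ * h₀ f u) +
            C₁ * (ρ u * h₁ f u + ρ u * (powerWeight θ₁ a₁ (K f) u * B₁ u)) := by ring
        _ ≤ C₀ * (h₀ f u + A₀ * h₀ f u) + C₁ * (ρ u * h₁ f u + A₀ * h₀ f u) := by
            rw [e₃]
            gcongr
        -- The added terms are exactly those missing from a common constant in front of `H f u`.
        _ ≤ C₀ * (h₀ f u + A₀ * h₀ f u) + C₁ * (ρ u * h₁ f u + A₀ * h₀ f u) +
            (C₁ * h₀ f u + (C₀ + C₀ * A₀ + C₁ * A₀) * (ρ u * h₁ f u)) := le_self_add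
        _ = _ := by
            push_cast
            ring
    have hfin' := e₄.trans_lt (ENNReal.mul_lt_top ENNReal.coe_lt_top hfin)
    have hf₀fin : N₀ f₀ < ∞ := le_self_add.trans_lt hfin'
    have hf₁fin : N₁ f₁ < ∞ :=
      ENNReal.lt_top_of_mul_ne_top_right (le_add_self.trans_lt hfin').ne (hρ0 u hu)
    rw [hff]
    exact (peetreK_le hf₀fin hf₁fin).trans (hff ▸ e₄)
  have lower : ∀ g₀ g₁, N₀ g₀ < ∞ → N₁ g₁ < ∞ → ∀ u, 0 < u → H (g₀ + g₁) u ≤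
      (κ * (1 + D₁ * A₀ + D₀ * A₁) + κ : ℝ≥0) * (N₀ g₀ + ρ u * N₁ g₁) := by
    intro g₀ g₁ hg₀ hg₁ u hu
    have hKadd : ∀ s, K (g₀ + g₁) s ≤ κ * (K g₀ s + K g₁ s) := fun s => hadd _ _ _
    have s₀ : h₀ (g₀ + g₁) u ≤ κ * (h₀ g₀ u + h₀ g₁ u) :=
      RISpace.iterNorm_le_of_le_add E₀ F₀ measurableSet_Ioo (fun _ => measurableSet_Ioo)
        (F₀.measurable_tildeNormOn_of_antitone fun _ _ h => Ioo_subset_Ioo_left h) hma₀ hmb₀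
        (hK g₀).mono (hK g₁).mono hKadd
    have s₁ : h₁ (g₀ + g₁) u ≤ κ * (h₁ g₀ u + h₁ g₁ u) :=
      RISpace.iterNorm_le_of_le_add E₁ F₁ measurableSet_Ioi (fun _ => measurableSet_Ioo)
        (F₁.measurable_tildeNormOn_of_monotone fun _ _ h => Ioo_subset_Ioo_right h) hma₁ hmb₁
        (hK g₀).mono (hK g₁).mono hKadd
    have t₀ : ∀ s, h₀ g₀ s ≤ N₀ g₀ := fun s => by
      rw [hN₀ g₀ (hsum₀ g₀ hg₀)]
      refine E₀.tildeNormOn_mono fun t _ _ => ⟨mem_univ t, ?_⟩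
      gcongr
      exact F₀.tildeNormOn_mono fun x _ hx => ⟨hx.1, le_rfl⟩
    have t₁ : h₁ g₁ u ≤ N₁ g₁ := by
      rw [hN₁ g₁ (hsum₁ g₁ hg₁)]
      refine E₁.tildeNormOn_mono fun t _ _ => ⟨mem_univ t, ?_⟩
      gcongr
      exact F₁.tildeNormOn_mono fun x hx0 hx => ⟨⟨hx0, hx.2⟩, le_rfl⟩
    have hd0 : ENNReal.ofReal (u ^ (-θ₁) * a₁ u) * B₁ u ≠ 0 :=
      mul_ne_zero (hw₁ u hu) (hB₁pos u hu)
    have hdt : ENNReal.ofReal (u ^ (-θ₁) * a₁ u) * B₁ u ≠ ∞ :=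
      ENNReal.mul_ne_top ENNReal.ofReal_ne_top (hB₁fin u hu)
    -- The first cross term. The pointwise bound on `K g₀` is needed at all `s`, hence `t₀` for all
    -- `s`; the balance of `ρ` then lets the factor `w₁(u) B₁(u)` cancel.
    have x₁ : ρ u * h₁ g₀ u ≤ D₁ * A₀ * N₀ g₀ := by
      have h := hD₁ B₀ (K g₀) (A₀ * N₀ g₀) hB₀mono (hK g₀).mono (fun s hs =>
        (hA₀ (K g₀) (hK g₀) s hs).trans (mul_le_mul_right (t₀ s) _)) u hu
      rw [← hρ u hu] at h
      rw [← ENNReal.mul_le_mul_iff_right hd0 hdt]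
      calc _ = ρ u * (ENNReal.ofReal (u ^ (-θ₁) * a₁ u) * B₁ u) * h₁ g₀ u := by ring
        _ ≤ _ := h
        _ = _ := by ring
    have x₀ : h₀ g₁ u ≤ D₀ * A₁ * (ρ u * N₁ g₁) := by
      have h := hD₀ B₁ (K g₁) (A₁ * N₁ g₁) hB₁anti (hK g₁).mono (fun s hs =>
        (hA₁ (K g₁) (hK g₁) s hs).trans_eq (by rw [hN₁ g₁ (hsum₁ g₁ hg₁)])) u hu
      rw [← hρ u hu] at h
      rw [← ENNReal.mul_le_mul_iff_right hd0 hdt]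
      calc _ ≤ _ := h
        _ = _ := by ring
    rw [hH]
    calc _ ≤ κ * (N₀ g₀ + D₀ * A₁ * (ρ u * N₁ g₁)) + ρ u * (κ * (h₁ g₀ u + N₁ g₁)) := by
          gcongr
          · exact s₀.trans (by gcongr; exact t₀ u)
          · exact s₁.trans (by gcongr)
      _ = κ * (N₀ g₀ + D₀ * A₁ * (ρ u * N₁ g₁)) + κ * (ρ u * h₁ g₀ u + ρ u * N₁ g₁) := by ring
      _ ≤ κ * (N₀ g₀ + D₀ * A₁ * (ρ u * N₁ g₁)) +
          κ * (D₁ * A₀ * N₀ g₀ + ρ u * N₁ g₁) := by gcongr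
      _ ≤ κ * (N₀ g₀ + D₀ * A₁ * (ρ u * N₁ g₁)) +
          κ * (D₁ * A₀ * N₀ g₀ + ρ u * N₁ g₁) + ((κ + κ * D₀ * A₁) * N₀ g₀ +
            (κ + κ * D₁ * A₀) * (ρ u * N₁ g₁)) := le_self_add
      _ = _ := by
          push_cast
          ring
  set c₁ : ℝ≥0 := (C₀ + C₁) * (1 + A₀)
  set c₂ : ℝ≥0 := κ * (1 + D₁ * A₀ + D₀ * A₁) + κ
  have hC : ((c₁ + c₂ + 1 : ℝ≥0) : ℝ≥0∞) ≠ 0 := by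
    exact_mod_cast (add_pos_of_nonneg_of_pos zero_le one_pos).ne'
  -- The `1` keeps the constant nonzero, which settles the case `H f u = ∞` and permits dividing by
  -- it under the infimum.
  refine ⟨c₁ + c₂ + 1, by positivity, fun f hf u hu => ⟨?_, ?_⟩⟩
  · rcases eq_or_ne (H f u) ∞ with h | h
    · rw [h, ENNReal.mul_top hC]
      exact le_top
    · refine (upper f hf u hu (lt_top_iff_ne_top.2 h)).trans ?_
      gcongr
      rw [add_assoc]
      exact le_self_add
  · rw [mul_comm, ← ENNReal.div_le_iff_le_mul (Or.inl hC) (Or.inl ENNReal.coe_ne_top)]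
    refine le_peetreK fun g₀ g₁ hg₀ hg₁ hg => ?_
    rw [ENNReal.div_le_iff_le_mul (Or.inl hC) (Or.inl ENNReal.coe_ne_top), mul_comm, hg]
    refine (lower g₀ g₁ hg₀ hg₁ u hu).trans ?_
    gcongr
    rw [add_assoc, add_comm c₂, ← add_assoc]
    exact le_add_self

end
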